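/- Consider the first-order FIR system $y_k=\phi_k\theta+d_k$ with binary observations $s_k=I_{\{y_k\le C\}}$, $k\ge 1$, where $C\in\mathbb R$ is a known threshold, $\theta\in\mathbb R$ is the unknown parameter and $(\phi_k)_{k\ge1}$ is a deterministic real input sequence. Assume: 1. $|\theta|\le\bar\theta$ for a known constant $\bar\theta$; 2. $(d_k)_{k\ge1}$ are i.i.d. normal random variables with mean $0$ and known variance $\sigma^2>0$; let $F$ and $f$ be their distribution function and density; 3. $\bar\phi:=\sup_{k\ge1}|\phi_k|<\infty$, and there are an integer $N\ge1$ and a constant $\delta>0$ such that $\frac1N\sum_{i=k}^{k+N-1}\phi_i^2\ge\delta^2$ for all $k\ge1$. Put $M=\bar\phi\bar\theta+2$. Let $\hat\theta_0\in\mathbb R$ and $\hat P_0>0$ be arbitrary (deterministic) and let the information-matrix projection-free (IMPF) algorithm define, for $k\ge1$, $$z_k=\max\{-M,\min\{M,\phi_k\hat\theta_{k-1}\}\},\qquad \gamma_k=\begin{cases}1,&|\phi_k\hat\theta_{k-1}|\le M,\\ |\phi_k\hat\theta_{k-1}|,&|\phi_k\hat\theta_{k-1}|>M,\end{cases}$$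 $$\hat F_k=F(C-z_k),\quad \hat f_k=f(C-z_k),\quad \hat\alpha_k=\frac{\hat f_k}{\hat F_k(1-\hat F_k)},\quad \hat\beta_k=\frac{\hat f_k^2}{\hat F_k(1-\hat F_k)},$$ $$\hat P_k=\hat P_{k-1}-\frac{\hat\beta_k\hat P_{k-1}^2\phi_k^2}{1+\hat\beta_k\phi_k^2\hat P_{k-1}},\qquad \hat\theta_k=\hat\theta_{k-1}+\hat P_k\phi_k\gamma_k\hat\alpha_k(\hat F_k-s_k).$$ Let $\tilde\theta_k=\hat\theta_k-\theta$, $F_i=F(C-\phi_i\theta)$, $f_i=f(C-\phi_i\theta)$, and let $$\Delta_k=\Big(\sum_{i=1}^k\frac{f_i^2}{F_i(1-F_i)}\phi_i^2\Big)^{-1}$$ be the Cramér–Rao lower bound. Then $E\tilde\theta_k^2<\infty$ for all $k$, the sum defining $\Delta_k$ is positive for all $k\ge N$, and the IMPF algorithm is asymptotically efficient: $$\lim_{k\to\infty}\Delta_k^{-1}\big(E\tilde\theta_k^2-\Delta_k\big)=0 .$$ -/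

import Mathlib

open MeasureTheory ProbabilityTheory Filter Topology

noncomputable section

namespace BinaryFIR

/-- Probability distribution function `F` of the centred normal noise with variance `σ ^ 2`. -/
def noiseCDF (σ x : ℝ) : ℝ := cdf (gaussianReal 0 (Real.toNNReal (σ ^ 2))) x

/-- Probability density function `f` of the centred normal noise with variance `σ ^ 2`. -/
def noisePDF (σ x : ℝ) : ℝ := gaussianPDFReal 0 (Real.toNNReal (σ ^ 2)) x

/-- Output `y = φ θ + d` of the first-order system with input `φ`, parameter `θ`, noise `d`. -/
def output (θ φ d : ℝ) : ℝ := φ * θ + d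

/-- Binary-valued observation `s = I_{y ≤ C}`. -/
def observation (C y : ℝ) : ℝ := if y ≤ C then 1 else 0

/-- Cut-off coefficient: the prediction `x = φ θ̂` truncated to `[-M, M]`. -/
def cutoff (M x : ℝ) : ℝ := if M < x then M else if x < -M then -M else x

/-- Adaptive accelerated coefficient as a function of the prediction `x = φ θ̂`. -/
def accel (M x : ℝ) : ℝ := if |x| ≤ M then 1 else |x|

/-- `f(C - x) / (F(C - x) (1 - F(C - x)))`. -/
def alphaCoef (C σ x : ℝ) : ℝ :=
  noisePDF σ (C - x) / (noiseCDF σ (C - x) * (1 - noiseCDF σ (C - x)))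

/-- `f(C - x) ^ 2 / (F(C - x) (1 - F(C - x)))`. -/
def betaCoef (C σ x : ℝ) : ℝ :=
  noisePDF σ (C - x) ^ 2 / (noiseCDF σ (C - x) * (1 - noiseCDF σ (C - x)))

/-- Scalar gain update `P̂_{k-1} ↦ P̂_k` for the input `φ` and the weight `b = β̂_k`. -/
def gainUpdate (b φ P : ℝ) : ℝ := P - b * P * φ * φ * P / (1 + b * φ * P * φ)

/-- The pair `(θ̂_k, P̂_k)` produced by the first-order information-matrix projection-free
algorithm with cut-off level `M`, from the inputs `φ 1, φ 2, …` and the binary data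
`s 1, s 2, …`, started at `(θ₀, P₀)`. -/
def impf (C σ M : ℝ) (φ s : ℕ → ℝ) (θ₀ P₀ : ℝ) : ℕ → ℝ × ℝ
  | 0 => (θ₀, P₀)
  | k + 1 =>
    let θprev := (impf C σ M φ s θ₀ P₀ k).1
    let Pprev := (impf C σ M φ s θ₀ P₀ k).2
    let z := cutoff M (φ (k + 1) * θprev)
    let γ := accel M (φ (k + 1) * θprev)
    let Pnew := gainUpdate (betaCoef C σ z) (φ (k + 1)) Pprev
    (θprev + Pnew * φ (k + 1) * γ * alphaCoef C σ z * (noiseCDF σ (C - z) - s (k + 1)), Pnew)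

/-- The estimate `θ̂_k` as a random variable, when the data are the binary observations of the
system with parameter `θ`, inputs `φ` and noise `d`. -/
def estimate {Ω : Type*} (C σ M θ : ℝ) (φ : ℕ → ℝ) (d : ℕ → Ω → ℝ) (θ₀ P₀ : ℝ) (k : ℕ)
    (ω : Ω) : ℝ :=
  (impf C σ M φ (fun i => observation C (output θ (φ i) (d i ω))) θ₀ P₀ k).1

/-- `∑_{i=1}^k f_i ^ 2 / (F_i (1 - F_i)) φ_i ^ 2`, where `F_i = F(C - φ_i θ)` and
`f_i = f(C - φ_i θ)`. -/
def information (C σ θ : ℝ) (φ : ℕ → ℝ) (k : ℕ) : ℝ :=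
  ∑ i ∈ Finset.Icc 1 k, betaCoef C σ (φ i * θ) * φ i ^ 2

/-- The Cramér–Rao lower bound `Δ_k`. -/
def crBound (C σ θ : ℝ) (φ : ℕ → ℝ) (k : ℕ) : ℝ := (information C σ θ φ k)⁻¹

end BinaryFIR

end

noncomputable section

namespace BinaryFIR

/-! Let T be the estimation error, A the inverse gain, p the input, v the centred observation, D the
cumulated squared inputs (`gram`) and I the Fisher information. In information form the recursion
for A is additive, so A and I are of exact order D, and D tends to infinity by excitation. The
normalised error A T moves by p (b p T + h) - p g v, where h is the conditional mean of the
innovation (`normalised_succ`). The weights make h = -b p T to first order, so the linear terms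
cancel: A T is a martingale up to a quadratic remainder, with increments of conditional variance
close to p² β. Hence E (A T)² is I up to O(√D), as soon as E T⁴ = O(D⁻²).

That fourth moment bound is the main difficulty, because without projection T is not uniformly
bounded a priori. The accelerated coefficient gives a drift at least linear in the prediction error,
however large it is (`exists_score_bounds`). The resulting contraction rate of T may be small, but
passing to the power 2j+2 multiplies it by 2j+2, so some high moment is O(D⁻²)
(`exists_high_moment_le`). This moment controls the region where T is not small; elsewhere the
expansion of (A T)⁴ closes by itself (`exists_fourth_moment_le`).

Finally E (A - I)² = O(D^(3/2)), and Young's inequality gives E (A T)² - I² E T² = O(D^(3/4)).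
Altogether I (I E T² - 1) = O(D^(3/4)), and division by I leaves O(D^(-1/4)). -/

/-! ### The noise law and the coefficients: positivity, smoothness, bounds on compact intervals. -/

lemma toNNReal_sq_ne_zero {σ : ℝ} (hσ : 0 < σ) : Real.toNNReal (σ ^ 2) ≠ 0 := by
  simpa using hσ.ne'

lemma contDiff_noisePDF (σ : ℝ) : ContDiff ℝ 1 (noisePDF σ) := by
  unfold noisePDF
  rw [show (fun x => gaussianPDFReal 0 (Real.toNNReal (σ ^ 2)) x) = _ from
    gaussianPDFReal_def 0 (Real.toNNReal (σ ^ 2))]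
  fun_prop

lemma noisePDF_pos {σ : ℝ} (hσ : 0 < σ) (x : ℝ) : 0 < noisePDF σ x :=
  gaussianPDFReal_pos _ _ _ (toNNReal_sq_ne_zero hσ)

lemma noiseCDF_eq_integral {σ : ℝ} (hσ : 0 < σ) (x : ℝ) :
    noiseCDF σ x = ∫ t in Set.Iic x, noisePDF σ t := by
  unfold noiseCDF noisePDF
  rw [cdf_eq_real, measureReal_def, gaussianReal_apply_eq_integral _ (toNNReal_sq_ne_zero hσ),
    ENNReal.toReal_ofReal]
  exact integral_nonneg fun t => gaussianPDFReal_nonneg _ _ _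

lemma integrable_noisePDF (σ : ℝ) : Integrable (noisePDF σ) :=
  integrable_gaussianPDFReal _ _

lemma hasDerivAt_noiseCDF {σ : ℝ} (hσ : 0 < σ) (x : ℝ) :
    HasDerivAt (noiseCDF σ) (noisePDF σ x) x := by
  have hint := integrable_noisePDF σ
  have hcont := (contDiff_noisePDF σ).continuous
  have h : noiseCDF σ = fun u => noiseCDF σ 0 + ∫ t in (0 : ℝ)..u, noisePDF σ t := by
    funext u
    rw [noiseCDF_eq_integral hσ, noiseCDF_eq_integral hσ,
      ← intervalIntegral.integral_Iic_sub_Iic hint.integrableOn hint.integrableOn]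
    ring
  rw [h]
  exact (intervalIntegral.integral_hasDerivAt_right (hint.intervalIntegrable)
    (hcont.stronglyMeasurableAtFilter _ _) hcont.continuousAt).const_add _

lemma strictMono_noiseCDF {σ : ℝ} (hσ : 0 < σ) : StrictMono (noiseCDF σ) :=
  strictMono_of_hasDerivAt_pos (fun x => hasDerivAt_noiseCDF hσ x) fun x => noisePDF_pos hσ x

lemma noiseCDF_pos {σ : ℝ} (hσ : 0 < σ) (x : ℝ) : 0 < noiseCDF σ x :=
  (cdf_nonneg _ (x - 1)).trans_lt (strictMono_noiseCDF hσ (by linarith))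

lemma noiseCDF_lt_one {σ : ℝ} (hσ : 0 < σ) (x : ℝ) : noiseCDF σ x < 1 :=
  (strictMono_noiseCDF hσ (show x < x + 1 by linarith)).trans_le (cdf_le_one _ _)

lemma contDiff_noiseCDF {σ : ℝ} (hσ : 0 < σ) : ContDiff ℝ 1 (noiseCDF σ) := by
  rw [contDiff_one_iff_deriv]
  refine ⟨fun x => (hasDerivAt_noiseCDF hσ x).differentiableAt, ?_⟩
  rw [show deriv (noiseCDF σ) = noisePDF σ from funext fun x => (hasDerivAt_noiseCDF hσ x).deriv]
  exact (contDiff_noisePDF σ).continuous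

lemma bernoulliVar_pos {σ : ℝ} (hσ : 0 < σ) (x : ℝ) :
    0 < noiseCDF σ x * (1 - noiseCDF σ x) :=
  mul_pos (noiseCDF_pos hσ x) (sub_pos.2 (noiseCDF_lt_one hσ x))

lemma contDiff_alphaCoef (C : ℝ) {σ : ℝ} (hσ : 0 < σ) : ContDiff ℝ 1 (alphaCoef C σ) := by
  have h1 := contDiff_noiseCDF hσ
  have h2 := contDiff_noisePDF σ
  unfold alphaCoef
  exact ContDiff.div (by fun_prop) (by fun_prop) fun x => (bernoulliVar_pos hσ _).ne'

lemma contDiff_betaCoef (C : ℝ) {σ : ℝ} (hσ : 0 < σ) : ContDiff ℝ 1 (betaCoef C σ) := by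
  have h1 := contDiff_noiseCDF hσ
  have h2 := contDiff_noisePDF σ
  unfold betaCoef
  exact ContDiff.div (by fun_prop) (by fun_prop) fun x => (bernoulliVar_pos hσ _).ne'

lemma alphaCoef_pos (C : ℝ) {σ : ℝ} (hσ : 0 < σ) (x : ℝ) : 0 < alphaCoef C σ x :=
  div_pos (noisePDF_pos hσ _) (bernoulliVar_pos hσ _)

lemma betaCoef_pos (C : ℝ) {σ : ℝ} (hσ : 0 < σ) (x : ℝ) : 0 < betaCoef C σ x :=
  div_pos (pow_pos (noisePDF_pos hσ _) 2) (bernoulliVar_pos hσ _)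

lemma betaCoef_eq_alphaCoef_mul (C σ x : ℝ) :
    betaCoef C σ x = alphaCoef C σ x * noisePDF σ (C - x) := by
  unfold betaCoef alphaCoef; ring

/-- This identity makes the conditional variance of the innovation at the true parameter equal to
the Fisher weight, which is what efficiency requires. -/
lemma betaCoef_eq_alphaCoef_sq_mul (C : ℝ) {σ : ℝ} (hσ : 0 < σ) (x : ℝ) :
    betaCoef C σ x = alphaCoef C σ x ^ 2 *
      (noiseCDF σ (C - x) * (1 - noiseCDF σ (C - x))) := by
  unfold betaCoef alphaCoef
  have := (bernoulliVar_pos hσ (C - x)).ne'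
  field_simp

/-- A positive `C¹` function is bounded above, bounded away from zero and Lipschitz on a bounded
interval. -/
lemma exists_bounds_of_contDiff {f : ℝ → ℝ} (hf : ContDiff ℝ 1 f) (hpos : ∀ x, 0 < f x) {M : ℝ}
    (hM : 0 ≤ M) :
    ∃ c K, 0 < c ∧ (∀ x ∈ Set.Icc (-M) M, c ≤ f x ∧ f x ≤ K) ∧
      ∀ x ∈ Set.Icc (-M) M, ∀ y ∈ Set.Icc (-M) M, |f x - f y| ≤ K * |x - y| := by
  have hne : (Set.Icc (-M) M).Nonempty := ⟨0, by constructor <;> linarith⟩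
  obtain ⟨a, -, ha⟩ := isCompact_Icc.exists_isMinOn hne hf.continuous.continuousOn
  obtain ⟨b, -, hb⟩ := isCompact_Icc.exists_isMaxOn hne hf.continuous.continuousOn
  obtain ⟨L, hL⟩ := LocallyLipschitzOn.exists_lipschitzOnWith_of_compact
    (isCompact_Icc (a := -M) (b := M)) (hf.locallyLipschitz.locallyLipschitzOn)
  refine ⟨f a, max (f b) L, hpos a, fun x hx => ⟨ha hx, le_max_of_le_left (hb hx)⟩,
    fun x hx y hy => ?_⟩
  have := hL.dist_le_mul x hx y hy
  rw [Real.dist_eq, Real.dist_eq] at this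
  exact this.trans (mul_le_mul_of_nonneg_right (le_max_right _ _) (abs_nonneg _))

/-- Mean value theorem. The intermediate point lies between `z` and `y`, so its distance to `z` is
at most `|z - y|`; the slope may then be replaced by the density at `z` with a first order error. -/
lemma exists_mem_noiseCDF_sub_eq (C : ℝ) {σ : ℝ} (hσ : 0 < σ) {M z y : ℝ}
    (hz : z ∈ Set.Icc (-M) M) (hy : y ∈ Set.Icc (-M) M) :
    ∃ ξ ∈ Set.Icc (-M) M, |z - ξ| ≤ |z - y| ∧
      noiseCDF σ (C - z) - noiseCDF σ (C - y) = -noisePDF σ (C - ξ) * (z - y) := by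
  have hd : ∀ x, HasDerivAt (fun x => noiseCDF σ (C - x)) (-noisePDF σ (C - x)) x := fun x => by
    have := (hasDerivAt_noiseCDF hσ (C - x)).comp x ((hasDerivAt_id x).const_sub C)
    simpa using! this
  have key : ∀ u v, u < v → ∃ ξ ∈ Set.Ioo u v,
      noiseCDF σ (C - v) - noiseCDF σ (C - u) = -noisePDF σ (C - ξ) * (v - u) := fun u v huv => by
    obtain ⟨ξ, hξ, he⟩ := exists_hasDerivAt_eq_slope (fun x => noiseCDF σ (C - x))
      (fun x => -noisePDF σ (C - x)) huv
      (fun x _ => (hd x).continuousAt.continuousWithinAt) (fun x _ => hd x)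
    refine ⟨ξ, hξ, ?_⟩
    have : v - u ≠ 0 := (sub_pos.2 huv).ne'
    rw [he]; field_simp
  rcases lt_trichotomy z y with h | h | h
  · obtain ⟨ξ, ⟨h1, h2⟩, he⟩ := key z y h
    refine ⟨ξ, ⟨by linarith [hz.1], by linarith [hy.2]⟩, ?_, by linarith⟩
    rw [abs_of_neg (by linarith), abs_of_neg (by linarith)]; linarith
  · subst h; exact ⟨z, hz, le_refl _, by ring⟩
  · obtain ⟨ξ, ⟨h1, h2⟩, he⟩ := key y z h
    refine ⟨ξ, ⟨by linarith [hy.1], by linarith [hz.2]⟩, ?_, by linarith⟩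
    rw [abs_of_pos (by linarith), abs_of_pos (by linarith)]; linarith

/-- Local estimates for the coefficients of the algorithm on `[-M, M]`. -/
lemma exists_coef_bounds (C : ℝ) {σ : ℝ} (hσ : 0 < σ) {M : ℝ} (hM : 0 ≤ M) :
    ∃ c K, 0 < c ∧ 1 ≤ K ∧ ∀ z ∈ Set.Icc (-M) M, ∀ y ∈ Set.Icc (-M) M,
      (c ≤ alphaCoef C σ z ∧ alphaCoef C σ z ≤ K) ∧ (c ≤ betaCoef C σ z ∧ betaCoef C σ z ≤ K) ∧
      |alphaCoef C σ z - alphaCoef C σ y| ≤ K * |z - y| ∧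
      |betaCoef C σ z - betaCoef C σ y| ≤ K * |z - y| ∧
      (∃ r, c ≤ r ∧ r ≤ K ∧ |noisePDF σ (C - z) - r| ≤ K * |z - y| ∧
        noiseCDF σ (C - z) - noiseCDF σ (C - y) = -r * (z - y)) := by
  obtain ⟨c1, K1, hc1, h1, l1⟩ := exists_bounds_of_contDiff (contDiff_alphaCoef C hσ)
    (alphaCoef_pos C hσ) hM
  obtain ⟨c2, K2, hc2, h2, l2⟩ := exists_bounds_of_contDiff (contDiff_betaCoef C hσ)
    (betaCoef_pos C hσ) hM
  have hp := contDiff_noisePDF σ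
  obtain ⟨c3, K3, hc3, h3, l3⟩ := exists_bounds_of_contDiff (f := fun x => noisePDF σ (C - x))
    (by fun_prop) (fun x => noisePDF_pos hσ _) hM
  have hK : ∀ K', K' ≤ max 1 (max K1 (max K2 K3)) → ∀ x ≥ (0 : ℝ),
      K' * x ≤ max 1 (max K1 (max K2 K3)) * x := fun K' h x hx => mul_le_mul_of_nonneg_right h hx
  have hK1 : K1 ≤ max 1 (max K1 (max K2 K3)) := by simp
  have hK2 : K2 ≤ max 1 (max K1 (max K2 K3)) := by simp
  have hK3 : K3 ≤ max 1 (max K1 (max K2 K3)) := by simp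
  refine ⟨min c1 (min c2 c3), max 1 (max K1 (max K2 K3)), by positivity, le_max_left _ _,
    fun z hz y hy => ⟨⟨(min_le_left _ _).trans (h1 z hz).1, (h1 z hz).2.trans hK1⟩,
      ⟨((min_le_right _ _).trans (min_le_left _ _)).trans (h2 z hz).1, (h2 z hz).2.trans hK2⟩,
      (l1 z hz y hy).trans (hK _ hK1 _ (abs_nonneg _)),
      (l2 z hz y hy).trans (hK _ hK2 _ (abs_nonneg _)), ?_⟩⟩
  obtain ⟨ξ, hξ, hd, he⟩ := exists_mem_noiseCDF_sub_eq C hσ hz hy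
  refine ⟨_, ((min_le_right _ _).trans (min_le_right _ _)).trans (h3 ξ hξ).1,
    (h3 ξ hξ).2.trans hK3, ?_, he⟩
  exact ((l3 z hz ξ hξ).trans (hK _ hK3 _ (abs_nonneg _))).trans
    (mul_le_mul_of_nonneg_left hd (zero_le_one.trans (le_max_left _ _)))

lemma cutoff_mem_Icc {M : ℝ} (hM : 0 ≤ M) (x : ℝ) : cutoff M x ∈ Set.Icc (-M) M := by
  unfold cutoff
  split_ifs <;> constructor <;> linarith

lemma cutoff_of_abs_le {M x : ℝ} (h : |x| ≤ M) : cutoff M x = x := by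
  rw [abs_le] at h
  simp [cutoff, not_lt.2 h.1, not_lt.2 h.2]

/-! ### Bounds for the innovation, inside and outside the cut-off. -/

/-- Coefficient of the observation error in the update of the estimate. -/
def scoreCoef (C σ M x : ℝ) : ℝ := accel M x * alphaCoef C σ (cutoff M x)

/-- Mean of the innovation at the prediction `x` when the noise-free output is `y`. -/
def meanScore (C σ M x y : ℝ) : ℝ :=
  scoreCoef C σ M x * (noiseCDF σ (C - cutoff M x) - noiseCDF σ (C - y))

/-- Inside the cut-off the innovation is `a * (-r * e)`, with `r` the mean value slope. Since `b = a
* f`, the sum `b * e + a * (-r * e)` is `a * (f - r) * e`, which is quadratic because `f - r` is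
itself of order `e`. -/
lemma score_bounds_inside {c K a a' r f V b e : ℝ} (hc : 0 < c) (hK : 1 ≤ K)
    (ha1 : c ≤ a) (ha2 : a ≤ K) (hay1 : c ≤ a') (hay2 : a' ≤ K) (hr1 : c ≤ r) (hr2 : r ≤ K)
    (hV0 : 0 < V) (hV1 : V ≤ 1) (hal : |a - a'| ≤ K * |e|) (hrl : |f - r| ≤ K * |e|)
    (hb : b = a * f) :
    a * (-r * e) * e ≤ -c ^ 2 * e ^ 2 ∧ |a * (-r * e)| ≤ K ^ 2 * |e| ∧ |a| ≤ K * (1 + |e|) ∧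
      |b * e + a * (-r * e)| ≤ K ^ 2 * e ^ 2 ∧
      |a ^ 2 * V - a' ^ 2 * V| ≤ 2 * K ^ 2 * |e| := by
  have ha0 : 0 < a := by linarith
  have hr0 : 0 < r := by linarith
  have hay0 : 0 < a' := by linarith
  have hK0 : 0 < K := by linarith
  have hcar : c ^ 2 ≤ a * r := by nlinarith
  have harK : a * r ≤ K ^ 2 := by nlinarith
  have he := abs_nonneg e
  refine ⟨?_, ?_, ?_, ?_, ?_⟩
  · nlinarith [mul_le_mul_of_nonneg_right hcar (sq_nonneg e)]
  · rw [show a * (-r * e) = -(a * r * e) by ring, abs_neg, abs_mul, abs_of_pos (mul_pos ha0 hr0)]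
    exact mul_le_mul_of_nonneg_right harK he
  · rw [abs_of_pos ha0]; nlinarith
  · rw [hb, show a * f * e + a * (-r * e) = a * ((f - r) * e) by ring, abs_mul, abs_mul,
      abs_of_pos ha0, ← sq_abs e]
    calc a * (|f - r| * |e|) ≤ K * (K * |e| * |e|) :=
          mul_le_mul ha2 (mul_le_mul_of_nonneg_right hrl he) (by positivity) (by linarith)
      _ = K ^ 2 * |e| ^ 2 := by ring
  · rw [show a ^ 2 * V - a' ^ 2 * V = (a - a') * ((a + a') * V) by ring, abs_mul,
      abs_of_pos (by positivity : 0 < (a + a') * V)]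
    calc |a - a'| * ((a + a') * V) ≤ K * |e| * (2 * K) :=
          mul_le_mul hal (by nlinarith) (by positivity) (by positivity)
      _ = 2 * K ^ 2 * |e| := by ring

/-- Here `w` is the truncated prediction error and `X` the acceleration factor. The factor `X`
restores the linear growth that truncation removes, which keeps the drift coercive. Since `|e| ≥ 2`,
constants and linear terms are absorbed into `e ^ 2`, so the quadratic bounds need no Taylor
argument. -/
lemma score_bounds_outside {c K M a a' r V b b' e w X : ℝ} (hc : 0 < c) (hK : 1 ≤ K)
    (hM : 2 ≤ M) (ha1 : c ≤ a) (ha2 : a ≤ K) (hay1 : c ≤ a') (hay2 : a' ≤ K) (hr1 : c ≤ r)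
    (hr2 : r ≤ K) (hb1 : c ≤ b) (hb2 : b ≤ K) (hby1 : c ≤ b') (hby2 : b' ≤ K)
    (hV0 : 0 < V) (hV1 : V ≤ 1) (he : 2 ≤ |e|) (hX0 : 0 ≤ X) (hX : X ≤ (1 + M) * |e|)
    (hw : |w| ≤ 2 * (1 + M)) (hXw : |e| ≤ X * |w|) (hsign : w * e = |w| * |e|) :
    X * a * (-r * w) * e ≤ -c ^ 2 * e ^ 2 ∧
      |X * a * (-r * w)| ≤ 2 * (K ^ 2 * (1 + M) ^ 2) * |e| ∧
      |X * a| ≤ K * (1 + M) * |e| ∧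
      |b * e + X * a * (-r * w)| ≤ (2 * (K ^ 2 * (1 + M) ^ 2)) * e ^ 2 ∧
      |(X * a) ^ 2 * V - a' ^ 2 * V| ≤ K ^ 2 * (1 + M) ^ 2 * e ^ 2 ∧ |b - b'| ≤ K * |e| := by
  have ha0 : 0 < a := by linarith
  have hr0 : 0 < r := by linarith
  have hcar : c ^ 2 ≤ a * r := by nlinarith
  have harK : a * r ≤ K ^ 2 := by nlinarith
  have hw0 := abs_nonneg w
  have h2 : |X * a * (-r * w)| ≤ 2 * (K ^ 2 * (1 + M) ^ 2) * |e| := by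
    rw [show X * a * (-r * w) = -(a * r * (X * w)) by ring, abs_neg, abs_mul,
      abs_of_pos (mul_pos ha0 hr0), abs_mul, abs_of_nonneg hX0]
    calc a * r * (X * |w|) ≤ K ^ 2 * ((1 + M) * |e| * (2 * (1 + M))) :=
          mul_le_mul harK (mul_le_mul hX hw hw0 (by positivity)) (by positivity) (by positivity)
      _ = _ := by ring
  refine ⟨?_, h2, ?_, ?_, ?_, ?_⟩
  · have h1 : X * a * (-r * w) * e = -(a * r * (X * |w| * |e|)) := by
      linear_combination (-(X * a * r)) * hsign
    have h3 : c ^ 2 * (|e| * |e|) ≤ a * r * (X * |w| * |e|) :=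
      mul_le_mul hcar (mul_le_mul_of_nonneg_right hXw (abs_nonneg e)) (by positivity)
        (by positivity)
    rw [h1, ← sq_abs e]; nlinarith
  · rw [abs_of_nonneg (by positivity)]
    calc X * a ≤ (1 + M) * |e| * K := mul_le_mul hX ha2 ha0.le (by positivity)
      _ = _ := by ring
  · have hKL : K ≤ 2 * (K ^ 2 * (1 + M) ^ 2) := by
      have : 1 ≤ (1 + M) ^ 2 := by nlinarith
      have : K ^ 2 * 1 ≤ K ^ 2 * (1 + M) ^ 2 := mul_le_mul_of_nonneg_left this (by positivity)
      nlinarith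
    have h4 : |b * e| ≤ 2 * (K ^ 2 * (1 + M) ^ 2) * |e| := by
      rw [abs_mul, abs_of_pos (by linarith)]
      exact mul_le_mul_of_nonneg_right (hb2.trans hKL) (abs_nonneg e)
    have h5 := abs_add_le (b * e) (X * a * (-r * w))
    rw [← sq_abs e]
    have h6 : 0 ≤ 2 * (K ^ 2 * (1 + M) ^ 2) := by positivity
    nlinarith [mul_le_mul_of_nonneg_left he (mul_nonneg h6 (abs_nonneg e))]
  · have h6 : (X * a) ^ 2 * V ≤ K ^ 2 * (1 + M) ^ 2 * e ^ 2 := by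
      have : X * a ≤ (1 + M) * |e| * K := mul_le_mul hX ha2 ha0.le (by positivity)
      have : (X * a) ^ 2 ≤ ((1 + M) * |e| * K) ^ 2 := pow_le_pow_left₀ (by positivity) this 2
      rw [mul_pow _ K, mul_pow _ |e|, sq_abs] at this
      have h8 := mul_le_mul_of_nonneg_left hV1 (sq_nonneg (X * a))
      linarith
    have h7 : a' ^ 2 * V ≤ K ^ 2 * (1 + M) ^ 2 * e ^ 2 := by
      have h71 : a' ^ 2 * V ≤ K ^ 2 := by nlinarith
      have h72 : 1 ≤ (1 + M) ^ 2 * e ^ 2 := by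
        rw [← sq_abs e, ← mul_pow]
        exact one_le_pow₀ (by nlinarith)
      nlinarith [mul_le_mul_of_nonneg_left h72 (sq_nonneg K)]
    have h8 := mul_nonneg (sq_nonneg (X * a)) hV0.le
    have h9 := mul_nonneg (sq_nonneg a') hV0.le
    exact abs_le.2 ⟨by linarith, by linarith⟩
  · rw [abs_le]; constructor <;> nlinarith

/-- The margin 2 between `|y|` and `M` keeps the truncated prediction at distance at least 2 from
`y`. As `|y| < |x|`, this gives `|x - y| ≤ 2 * |x|`, which is at most `|x|` times the truncated
error. -/
lemma cutoff_sub_bounds {M x y : ℝ} (hM : 2 ≤ M) (hx : M < |x|) (hy : |y| ≤ M - 2) :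
    2 ≤ |x - y| ∧ |x| ≤ (1 + M) * |x - y| ∧ |cutoff M x - y| ≤ 2 * (1 + M) ∧
      |x - y| ≤ |x| * |cutoff M x - y| ∧
      (cutoff M x - y) * (x - y) = |cutoff M x - y| * |x - y| := by
  obtain ⟨h1, h2⟩ := abs_le.1 hy
  rcases lt_abs.1 hx with h | h
  · have hz : cutoff M x = M := by simp [cutoff, h]
    rw [hz, abs_of_pos (by linarith : 0 < x), abs_of_pos (by linarith : 0 < x - y),
      abs_of_pos (by linarith : 0 < M - y)]
    refine ⟨by linarith, by nlinarith, by linarith, by nlinarith, rfl⟩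
  · have hz : cutoff M x = -M := by
      have h3 : ¬ M < x := by linarith
      have h4 : x < -M := by linarith
      simp [cutoff, h3, h4]
    rw [hz, abs_of_neg (by linarith : x < 0), abs_of_neg (by linarith : x - y < 0),
      abs_of_neg (by linarith : -M - y < 0)]
    refine ⟨by linarith, by nlinarith, by linarith, by nlinarith, by ring⟩

/-- Global estimates for the innovation of the algorithm in terms of the prediction error. -/
lemma exists_score_bounds (C : ℝ) {σ : ℝ} (hσ : 0 < σ) {M : ℝ} (hM : 2 ≤ M) :
    ∃ c K, 0 < c ∧ 1 ≤ K ∧ ∀ x y, |y| ≤ M - 2 →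
      meanScore C σ M x y * (x - y) ≤ -c * (x - y) ^ 2 ∧
      |meanScore C σ M x y| ≤ K * |x - y| ∧
      |scoreCoef C σ M x| ≤ K * (1 + |x - y|) ∧
      |betaCoef C σ (cutoff M x) * (x - y) + meanScore C σ M x y| ≤ K * (x - y) ^ 2 ∧
      |scoreCoef C σ M x ^ 2 * (noiseCDF σ (C - y) * (1 - noiseCDF σ (C - y))) -
        betaCoef C σ y| ≤ K * (|x - y| + (x - y) ^ 2) ∧
      |betaCoef C σ (cutoff M x) - betaCoef C σ y| ≤ K * |x - y| ∧
      (c ≤ betaCoef C σ (cutoff M x) ∧ betaCoef C σ (cutoff M x) ≤ K) ∧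
      (c ≤ betaCoef C σ y ∧ betaCoef C σ y ≤ K) := by
  obtain ⟨c, K, hc, hK, H⟩ := exists_coef_bounds C hσ (by linarith : 0 ≤ M)
  refine ⟨min (c ^ 2) c, 4 * (K ^ 2 * (1 + M) ^ 2), by positivity, ?_, fun x y hy => ?_⟩
  · nlinarith [one_le_pow₀ hK (n := 2), one_le_pow₀ (by linarith : 1 ≤ 1 + M) (n := 2)]
  have hyM : y ∈ Set.Icc (-M) M := by
    rw [abs_le] at hy; constructor <;> linarith [hy.1, hy.2]
  obtain ⟨⟨ha1, ha2⟩, ⟨hb1, hb2⟩, hal, hbl, r, hr1, hr2, hrl, hr⟩ :=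
    H (cutoff M x) (cutoff_mem_Icc (by linarith) x) y hyM
  obtain ⟨⟨hay1, hay2⟩, ⟨hby1, hby2⟩, -⟩ := H y hyM y hyM
  have hV0 := bernoulliVar_pos hσ (C - y)
  have hV1 : noiseCDF σ (C - y) * (1 - noiseCDF σ (C - y)) ≤ 1 := by
    nlinarith [sq_nonneg (noiseCDF σ (C - y) - 1)]
  have hbV := betaCoef_eq_alphaCoef_sq_mul C hσ y
  have hba := betaCoef_eq_alphaCoef_mul C σ (cutoff M x)
  have hKK : K ≤ K ^ 2 := by nlinarith
  have hM2 : 1 ≤ (1 + M) ^ 2 := by nlinarith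
  have hKM : K ^ 2 ≤ K ^ 2 * (1 + M) ^ 2 := le_mul_of_one_le_right (by positivity) hM2
  have hKM1 : K * (1 + M) ≤ K ^ 2 * (1 + M) ^ 2 :=
    mul_le_mul hKK (by nlinarith) (by linarith) (by positivity)
  have hc1 : min (c ^ 2) c ≤ c ^ 2 := min_le_left _ _
  have hc2 : min (c ^ 2) c ≤ c := min_le_right _ _
  have he0 := abs_nonneg (x - y)
  have hL0 : 0 ≤ K ^ 2 * (1 + M) ^ 2 := by positivity
  have hsq := sq_nonneg (x - y)
  unfold meanScore scoreCoef
  rw [hr]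
  have hlast : (min (c ^ 2) c ≤ betaCoef C σ (cutoff M x) ∧
      betaCoef C σ (cutoff M x) ≤ 4 * (K ^ 2 * (1 + M) ^ 2)) ∧
      (min (c ^ 2) c ≤ betaCoef C σ y ∧ betaCoef C σ y ≤ 4 * (K ^ 2 * (1 + M) ^ 2)) :=
    ⟨⟨by linarith, by linarith⟩, ⟨by linarith, by linarith⟩⟩
  have hmin : -c ^ 2 * (x - y) ^ 2 ≤ -(min (c ^ 2) c) * (x - y) ^ 2 :=
    mul_le_mul_of_nonneg_right (by linarith) hsq
  generalize min (c ^ 2) c = c' at *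
  generalize hL : K ^ 2 * (1 + M) ^ 2 = L at *
  by_cases hx : |x| ≤ M
  · rw [cutoff_of_abs_le hx] at *
    obtain ⟨i1, i2, i3, i4, i5⟩ := score_bounds_inside hc hK ha1 ha2 hay1 hay2 hr1 hr2 hV0 hV1
      hal hrl hba
    rw [← hbV] at i5
    simp only [accel, hx, if_true, one_mul]
    refine ⟨i1.trans hmin, i2.trans ?_, i3.trans ?_, i4.trans ?_, i5.trans ?_,
      hbl.trans ?_, hlast.1, hlast.2⟩
    · exact mul_le_mul_of_nonneg_right (by linarith) he0
    · exact mul_le_mul_of_nonneg_right (by linarith) (by linarith)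
    · exact mul_le_mul_of_nonneg_right (by linarith) hsq
    · linarith [mul_le_mul_of_nonneg_right hKM he0, mul_nonneg hL0 he0, mul_nonneg hL0 hsq]
    · exact mul_le_mul_of_nonneg_right (by linarith) he0
  · obtain ⟨j1, j2, j3, j4, j5⟩ := cutoff_sub_bounds hM (not_le.1 hx) hy
    obtain ⟨i1, i2, i3, i4, i5, i6⟩ := score_bounds_outside hc hK hM ha1 ha2 hay1 hay2 hr1 hr2
      hb1 hb2 hby1 hby2 hV0 hV1 j1 (abs_nonneg x) j2 j3 j4 j5
    rw [← hbV] at i5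
    rw [hL] at i2 i4 i5
    simp only [accel, hx, if_false]
    refine ⟨i1.trans hmin, i2.trans ?_, i3.trans ?_, i4.trans ?_, i5.trans ?_,
      i6.trans ?_, hlast.1, hlast.2⟩
    · exact mul_le_mul_of_nonneg_right (by linarith) he0
    · linarith [mul_le_mul_of_nonneg_right hKM1 he0, mul_nonneg hL0 he0]
    · exact mul_le_mul_of_nonneg_right (by linarith) hsq
    · linarith [mul_nonneg hL0 he0, mul_nonneg hL0 hsq]
    · exact mul_le_mul_of_nonneg_right (by linarith) he0

/-! ### Functions of finitely many binary observations. -/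

section DependsOnFirst

variable {Ω : Type*}

/-- The real function `X` of the outcome is determined by the values of `s 0, …, s (k - 1)`. -/
def DependsOnFirst (s : ℕ → Ω → ℝ) (k : ℕ) (X : Ω → ℝ) : Prop :=
  ∀ ω ω', (∀ i < k, s i ω = s i ω') → X ω = X ω'

lemma DependsOnFirst.mono {s : ℕ → Ω → ℝ} {k l : ℕ} (hkl : k ≤ l) {X : Ω → ℝ}
    (hX : DependsOnFirst s k X) : DependsOnFirst s l X :=
  fun ω ω' h => hX ω ω' fun i hi => h i (hi.trans_le hkl)

/-- Binary values of the first `k` terms of a sequence of real functions. -/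
def signs (s : ℕ → Ω → ℝ) (k : ℕ) (ω : Ω) (i : Finset.range k) : Bool := decide (s i ω = 1)

/-- The first `k` binary data take finitely many values, so such a function factors through a finite
type. Measurability, boundedness and independence of the future then come at once, and no
conditional expectation is needed. -/
lemma DependsOnFirst.exists_eq_comp {s : ℕ → Ω → ℝ} (hs : ∀ i ω, s i ω = 0 ∨ s i ω = 1) {k : ℕ}
    {X : Ω → ℝ} (hX : DependsOnFirst s k X) : ∃ G : (Finset.range k → Bool) → ℝ,
      X = fun ω => G (signs s k ω) := by
  have : Function.FactorsThrough X (signs s k) := fun ω ω' h => by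
    refine hX ω ω' fun i hi => ?_
    have h1 : decide (s i ω = 1) = decide (s i ω' = 1) :=
      congrFun h ⟨i, Finset.mem_range.2 hi⟩
    rcases hs i ω with h2 | h2 <;> rcases hs i ω' with h3 | h3 <;> simp_all
  exact ⟨Function.extend (signs s k) X 0, funext fun ω => (this.extend_apply 0 ω).symm⟩

variable [MeasurableSpace Ω]

lemma measurable_decide_eq_one : Measurable fun r : ℝ => decide (r = 1) := by
  apply measurable_to_bool
  have : (fun r : ℝ => decide (r = 1)) ⁻¹' {true} = {1} := by ext; simp
  rw [this]; exact measurableSet_singleton 1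

lemma DependsOnFirst.measurable {s : ℕ → Ω → ℝ} (hs : ∀ i ω, s i ω = 0 ∨ s i ω = 1)
    (hm : ∀ i, Measurable (s i)) {k : ℕ} {X : Ω → ℝ} (hX : DependsOnFirst s k X) :
    Measurable X := by
  obtain ⟨G, rfl⟩ := hX.exists_eq_comp hs
  exact (measurable_of_finite G).comp
    (measurable_pi_lambda _ fun i => measurable_decide_eq_one.comp (hm i))

lemma DependsOnFirst.integrable {μ : Measure Ω} [IsFiniteMeasure μ] {s : ℕ → Ω → ℝ}
    (hs : ∀ i ω, s i ω = 0 ∨ s i ω = 1) (hm : ∀ i, Measurable (s i)) {k : ℕ} {X : Ω → ℝ}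
    (hX : DependsOnFirst s k X) : Integrable X μ := by
  have hmeas := hX.measurable hs hm
  obtain ⟨G, rfl⟩ := hX.exists_eq_comp hs
  exact Integrable.of_bound hmeas.aestronglyMeasurable (∑ a, ‖G a‖)
    (Eventually.of_forall fun ω => Finset.single_le_sum (f := fun a => ‖G a‖)
      (fun _ _ => norm_nonneg _) (Finset.mem_univ _))

/-- A function of the first `k` of a sequence of independent binary variables is uncorrelated with
the centred variable number `k`. -/
lemma DependsOnFirst.integral_mul_sub_eq_zero {μ : Measure Ω} [IsProbabilityMeasure μ]
    {s : ℕ → Ω → ℝ} (hs : ∀ i ω, s i ω = 0 ∨ s i ω = 1) (hm : ∀ i, Measurable (s i))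
    (hind : iIndepFun s μ) {k : ℕ} {F : ℝ} (hF : ∫ ω, s k ω ∂μ = F) {X : Ω → ℝ}
    (hX : DependsOnFirst s k X) : ∫ ω, X ω * (s k ω - F) ∂μ = 0 := by
  have hmeas := hX.measurable hs hm
  have hsk : Integrable (s k) μ :=
    DependsOnFirst.integrable (k := k + 1) hs hm fun ω ω' h => h k (Nat.lt_succ_self k)
  obtain ⟨G, hG⟩ := hX.exists_eq_comp hs
  have hI := (hind.comp (fun _ r => decide (r = 1)) fun _ => measurable_decide_eq_one)
  have hI2 := hI.indepFun_finset (Finset.range k) {k} (by simp)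
    (fun i => measurable_decide_eq_one.comp (hm i))
  have hI3 : IndepFun X (fun ω => s k ω - F) μ := by
    have h1 := hI2.comp (measurable_of_finite G)
      (measurable_of_finite fun a : (({k} : Finset ℕ) → Bool) =>
        (if a ⟨k, Finset.mem_singleton_self k⟩ then (1 : ℝ) else 0) - F)
    convert! h1 using 1
    funext ω
    rcases hs k ω with h | h <;> simp [h]
  rw [hI3.integral_fun_mul_eq_mul_integral hmeas.aestronglyMeasurable
    ((hm k).sub_const F).aestronglyMeasurable, integral_sub hsk (integrable_const F), hF]
  simp

end DependsOnFirst

/-! ### Pointwise one-step inequalities for powers of the error. -/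

/-- Second order Taylor remainder of a power. Raising the exponent multiplies the remainder `E` by
`t + u` and adds `(n + 2) * t ^ (n + 1) * u ^ 2`, whence the induction. -/
lemma abs_add_pow_sub_le (n : ℕ) (t u : ℝ) :
    |(t + u) ^ (n + 2) - t ^ (n + 2) - (n + 2) * t ^ (n + 1) * u| ≤
      (n + 2) ^ 2 * u ^ 2 * (|t| + |u|) ^ n := by
  induction n with
  | zero =>
    rw [show (t + u) ^ (0 + 2) - t ^ (0 + 2) - ((0 : ℕ) + 2) * t ^ (0 + 1) * u = u ^ 2 by
      push_cast; ring, abs_of_nonneg (sq_nonneg u)]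
    push_cast; nlinarith [sq_nonneg u]
  | succ n ih =>
    set E := (t + u) ^ (n + 2) - t ^ (n + 2) - (n + 2) * t ^ (n + 1) * u with hE
    rw [show (t + u) ^ (n + 1 + 2) - t ^ (n + 1 + 2) - ((n + 1 : ℕ) + 2) * t ^ (n + 1 + 1) * u =
      (t + u) * E + (n + 2) * t ^ (n + 1) * u ^ 2 by rw [hE]; push_cast; ring]
    have hS : 0 ≤ |t| + |u| := by positivity
    have h1 : |(t + u) * E| ≤ (|t| + |u|) * ((n + 2) ^ 2 * u ^ 2 * (|t| + |u|) ^ n) := by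
      rw [abs_mul]
      exact mul_le_mul (abs_add_le t u) ih (abs_nonneg _) hS
    have h2 : |((n : ℝ) + 2) * t ^ (n + 1) * u ^ 2| ≤
        (n + 2) * (|t| + |u|) ^ (n + 1) * u ^ 2 := by
      rw [abs_mul, abs_mul, abs_pow, abs_of_nonneg (by positivity : (0 : ℝ) ≤ n + 2),
        abs_of_nonneg (sq_nonneg u)]
      gcongr
      linarith [abs_nonneg u]
    have h3 : 0 ≤ u ^ 2 * (|t| + |u|) ^ (n + 1) := by positivity
    have h4 : 0 ≤ (n : ℝ) * (u ^ 2 * (|t| + |u|) ^ (n + 1)) := by positivity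
    calc _ ≤ _ := abs_add_le _ _
      _ ≤ _ := add_le_add h1 h2
      _ = ((n : ℝ) ^ 2 + 5 * n + 6) * (u ^ 2 * (|t| + |u|) ^ (n + 1)) := by ring
      _ ≤ _ := by push_cast; nlinarith

/-- Used with `q = T ^ 2` and `w = D⁻¹`. If `q ≥ l * w` with `l` large, the left side is a small
multiple of `q ^ (j + 1)`; otherwise `q` is itself of order `w`, and `j ≥ 1` supplies the second
factor `w`. -/
lemma exists_remainder_balance {ε : ℝ} (hε : 0 < ε) {j : ℕ} (hj : 1 ≤ j) :
    ∃ C w₀, 0 ≤ C ∧ 0 < w₀ ∧ w₀ ≤ 1 ∧ ∀ q w : ℝ, 0 ≤ q → 0 < w → w ≤ w₀ →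
      (1 + q) * (q + w) ^ j * w ≤ ε * q ^ (j + 1) + C * w ^ 2 := by
  set l : ℝ := max 1 (2 ^ (j + 1) / ε) with hl
  have hl1 : 1 ≤ l := le_max_left _ _
  have hl0 : 0 < l := by linarith
  have hlε : 2 ^ (j + 1) ≤ ε * l := by
    have : 2 ^ (j + 1) / ε ≤ l := le_max_right _ _
    rwa [div_le_iff₀ hε, mul_comm] at this
  refine ⟨(1 + l) ^ (j + 1), l⁻¹, by positivity, by positivity, inv_le_one_of_one_le₀ hl1,
    fun q w hq hw hw0 => ?_⟩
  have hwl : l * w ≤ 1 := by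
    have := mul_le_mul_of_nonneg_left hw0 hl0.le
    rwa [mul_inv_cancel₀ hl0.ne'] at this
  have hw1 : w ≤ 1 := by nlinarith
  rcases le_total (l * w) q with h | h
  · have h1 : (q + w) ^ j ≤ (2 * q) ^ j := pow_le_pow_left₀ (by positivity) (by nlinarith) j
    have h2 : (1 + q) * w * l ≤ 2 * q := by nlinarith
    have h3 : (1 + q) * (q + w) ^ j * w * l ≤ ε * q ^ (j + 1) * l := by
      calc (1 + q) * (q + w) ^ j * w * l = ((1 + q) * w * l) * (q + w) ^ j := by ring
        _ ≤ (2 * q) * (2 * q) ^ j := mul_le_mul h2 h1 (by positivity) (by positivity)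
        _ = 2 ^ (j + 1) * q ^ (j + 1) := by rw [← mul_pow]; ring
        _ ≤ (ε * l) * q ^ (j + 1) := by gcongr
        _ = _ := by ring
    have := le_of_mul_le_mul_right h3 hl0
    have : 0 ≤ (1 + l) ^ (j + 1) * w ^ 2 := by positivity
    linarith
  · have h1 : (q + w) ^ j ≤ ((1 + l) * w) ^ j := pow_le_pow_left₀ (by positivity) (by nlinarith) j
    have h2 : w ^ j ≤ w := by
      simpa using pow_le_pow_of_le_one hw.le hw1 hj
    have h3 : (q + w) ^ j ≤ (1 + l) ^ j * w := h1.trans (by rw [mul_pow]; gcongr)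
    have h4 : 1 + q ≤ 1 + l := by nlinarith
    calc (1 + q) * (q + w) ^ j * w ≤ (1 + l) * ((1 + l) ^ j * w) * w := by gcongr
      _ = (1 + l) ^ (j + 1) * w ^ 2 := by ring
      _ ≤ _ := by
        have : 0 ≤ ε * q ^ (j + 1) := by positivity
        linarith

set_option maxHeartbeats 1000000 in
/-- One-step estimate for a high even power of the estimation error. -/
lemma exists_high_power_step {c K : ℝ} (hc : 0 < c) (hK : 1 ≤ K) (B : ℝ) :
    ∃ (j : ℕ) (C D₀ : ℝ), 3 ≤ j ∧ 0 ≤ C ∧ 1 ≤ D₀ ∧ ∀ T p h g v A D : ℝ, D₀ ≤ D → |p| ≤ B →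
      p ^ 2 ≤ D → c * D ≤ A → A ≤ K * D → |v| ≤ 1 → h * (p * T) ≤ -c * (p * T) ^ 2 →
      |h| ≤ K * |p * T| → |g| ≤ K * (1 + |p * T|) →
      (T + A⁻¹ * p * (h - g * v)) ^ (2 * j + 2) ≤
        (1 - 5 * (p ^ 2 / D)) * T ^ (2 * j + 2) + C * (p ^ 2 / D) / D ^ 2 -
          ((2 * j + 2) * T ^ (2 * j + 1) * (A⁻¹ * p * g)) * v := by
  -- The exponent is taken so large that `(2 * j + 2) * (c / K) ≥ 6`: the drift then contributes a
  -- contraction 6, of which the remainder uses 1. The shift by 3 makes the power at least 8.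
  obtain ⟨i, hi⟩ := exists_nat_ge (3 * K / c)
  set j := i + 3 with hj
  have hjc : 6 ≤ (2 * (j : ℝ) + 2) * (c / K) := by
    rw [div_le_iff₀ hc] at hi
    rw [← mul_div_assoc, le_div_iff₀ (by linarith), hj]
    push_cast; nlinarith
  set K1 : ℝ := K ^ 2 * (2 + 8 * B ^ 2) / c ^ 2 with hK1
  have hK1pos : 0 < K1 := by positivity
  set K2 : ℝ := (2 * j + 2) ^ 2 * K1 * (2 + 2 * K1) ^ j with hK2
  have hK2pos : 0 < K2 := by positivity
  -- With `ε = K2⁻¹` the remainder costs exactly one copy of `p ^ 2 * w * T ^ (2 * j + 2)`.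
  obtain ⟨C, w₀, hC, hw₀, hw₀1, H⟩ := exists_remainder_balance (inv_pos.2 hK2pos)
    (by omega : 1 ≤ j)
  refine ⟨j, K2 * C, w₀⁻¹, by omega, by positivity, (one_le_inv₀ hw₀).2 hw₀1, ?_⟩
  intro T p h g v A D hD hp hpD hA1 hA2 hv hh1 hh2 hg
  have hD0 : 0 < D := (inv_pos.2 hw₀).trans_le hD
  obtain ⟨w, hw⟩ : ∃ w, w = D⁻¹ := ⟨_, rfl⟩
  have hw0 : 0 < w := hw ▸ inv_pos.2 hD0
  have hww : w ≤ w₀ := by rw [hw]; exact inv_le_of_inv_le₀ hw₀ hD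
  have hw1 : w ≤ 1 := hww.trans hw₀1
  have hDw : D * w = 1 := by rw [hw]; exact mul_inv_cancel₀ hD0.ne'
  have hx : p ^ 2 * w ≤ 1 := hDw ▸ mul_le_mul_of_nonneg_right hpD hw0.le
  have hA0 : 0 < A := (mul_pos hc hD0).trans_le hA1
  have hAi0 : 0 < A⁻¹ := inv_pos.2 hA0
  have hAi1 : A⁻¹ ≤ w / c := by
    rw [le_div_iff₀ hc, inv_mul_le_iff₀ hA0]
    calc c = c * D * w := by rw [mul_assoc, hDw, mul_one]
      _ ≤ A * w := mul_le_mul_of_nonneg_right hA1 hw0.le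
  have hAi2 : w / K ≤ A⁻¹ := by
    rw [div_le_iff₀ (by linarith), le_inv_mul_iff₀ hA0]
    calc A * w ≤ K * D * w := mul_le_mul_of_nonneg_right hA2 hw0.le
      _ = K := by rw [mul_assoc, hDw, mul_one]
  set u := A⁻¹ * p * (h - g * v) with hu
  have hu2 : u ^ 2 ≤ K1 * (p ^ 2 * w ^ 2) * (1 + T ^ 2) := by
    have h1 : |h - g * v| ≤ K * (1 + 2 * |p * T|) := by
      have h2 : |g * v| ≤ K * (1 + |p * T|) := by
        rw [abs_mul]; exact (mul_le_of_le_one_right (abs_nonneg g) hv).trans hg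
      have := abs_sub h (g * v)
      linarith
    have h3 : (h - g * v) ^ 2 ≤ K ^ 2 * ((2 + 8 * B ^ 2) * (1 + T ^ 2)) := by
      rw [← sq_abs]
      have hpB : p ^ 2 ≤ B ^ 2 := sq_le_sq' (by linarith [neg_abs_le p]) ((le_abs_self p).trans hp)
      have h4 : (1 + 2 * |p * T|) ^ 2 ≤ 2 + 8 * (B ^ 2 * T ^ 2) := by
        have h5 : |p * T| ^ 2 ≤ B ^ 2 * T ^ 2 := by
          rw [sq_abs, mul_pow]; exact mul_le_mul_of_nonneg_right hpB (sq_nonneg T)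
        linarith [sq_nonneg (1 - 2 * |p * T|)]
      calc |h - g * v| ^ 2 ≤ (K * (1 + 2 * |p * T|)) ^ 2 := pow_le_pow_left₀ (abs_nonneg _) h1 2
        _ = K ^ 2 * (1 + 2 * |p * T|) ^ 2 := by ring
        _ ≤ _ := by
          apply mul_le_mul_of_nonneg_left _ (sq_nonneg K)
          linarith [sq_nonneg T, sq_nonneg B]
    have h6 : A⁻¹ ^ 2 ≤ (w / c) ^ 2 := pow_le_pow_left₀ hAi0.le hAi1 2
    calc u ^ 2 = A⁻¹ ^ 2 * (p ^ 2 * (h - g * v) ^ 2) := by rw [hu]; ring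
      _ ≤ (w / c) ^ 2 * (p ^ 2 * (K ^ 2 * ((2 + 8 * B ^ 2) * (1 + T ^ 2)))) := by gcongr
      _ = _ := by rw [hK1]; ring
  have hTu : (|T| + |u|) ^ 2 ≤ (2 + 2 * K1) * (T ^ 2 + w) := by
    have h1 : (|T| + |u|) ^ 2 ≤ 2 * T ^ 2 + 2 * u ^ 2 := by
      linarith [sq_nonneg (|T| - |u|), sq_abs T, sq_abs u]
    have h2 : (p ^ 2 * w ^ 2) * (1 + T ^ 2) ≤ w + T ^ 2 := by
      have h3 : p ^ 2 * w * w ≤ 1 * w := mul_le_mul_of_nonneg_right hx hw0.le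
      have h4 : p ^ 2 * w * (w * T ^ 2) ≤ 1 * (1 * T ^ 2) := by gcongr
      linarith
    linarith [mul_le_mul_of_nonneg_left h2 hK1pos.le]
  have hR : (2 * (j : ℝ) + 2) ^ 2 * u ^ 2 * (|T| + |u|) ^ (2 * j) ≤
      p ^ 2 * w * T ^ (2 * j + 2) + K2 * C * (p ^ 2 * w) * w ^ 2 := by
    rw [pow_mul]
    calc (2 * (j : ℝ) + 2) ^ 2 * u ^ 2 * ((|T| + |u|) ^ 2) ^ j
        ≤ (2 * (j : ℝ) + 2) ^ 2 * (K1 * (p ^ 2 * w ^ 2) * (1 + T ^ 2)) *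
          ((2 + 2 * K1) * (T ^ 2 + w)) ^ j := by gcongr
      _ = K2 * (p ^ 2 * w) * ((1 + T ^ 2) * (T ^ 2 + w) ^ j * w) := by
          rw [hK2, mul_pow (2 + 2 * K1)]; ring
      _ ≤ K2 * (p ^ 2 * w) * (K2⁻¹ * (T ^ 2) ^ (j + 1) + C * w ^ 2) := by
          gcongr
          exact H _ _ (sq_nonneg T) hw0 hww
      _ = _ := by
          rw [← pow_mul, show 2 * (j + 1) = 2 * j + 2 by ring]
          field_simp
  have hT0 : 0 ≤ T ^ (2 * j) := by rw [pow_mul]; positivity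
  have hdrift : (2 * (j : ℝ) + 2) * T ^ (2 * j + 1) * (A⁻¹ * p * h) ≤
      -6 * (p ^ 2 * w) * T ^ (2 * j + 2) := by
    have h1 : T ^ (2 * j) * A⁻¹ * (h * (p * T)) ≤ T ^ (2 * j) * A⁻¹ * (-c * (p * T) ^ 2) :=
      mul_le_mul_of_nonneg_left hh1 (by positivity)
    have h2 : (w / K) * (c * p ^ 2 * T ^ (2 * j + 2)) ≤ A⁻¹ * (c * p ^ 2 * T ^ (2 * j + 2)) :=
      mul_le_mul_of_nonneg_right hAi2 (by rw [pow_add]; positivity)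
    have h3 : 0 ≤ p ^ 2 * w * T ^ (2 * j + 2) := by rw [pow_add]; positivity
    calc (2 * (j : ℝ) + 2) * T ^ (2 * j + 1) * (A⁻¹ * p * h)
        = (2 * (j : ℝ) + 2) * (T ^ (2 * j) * A⁻¹ * (h * (p * T))) := by ring
      _ ≤ (2 * (j : ℝ) + 2) * (T ^ (2 * j) * A⁻¹ * (-c * (p * T) ^ 2)) := by gcongr
      _ = -((2 * (j : ℝ) + 2) * (A⁻¹ * (c * p ^ 2 * T ^ (2 * j + 2)))) := by ring
      _ ≤ -((2 * (j : ℝ) + 2) * ((w / K) * (c * p ^ 2 * T ^ (2 * j + 2)))) := by gcongr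
      _ = -(((2 * (j : ℝ) + 2) * (c / K)) * (p ^ 2 * w * T ^ (2 * j + 2))) := by ring
      _ ≤ -(6 * (p ^ 2 * w * T ^ (2 * j + 2))) := by gcongr
      _ = _ := by ring
  have hmain := (abs_le.1 (abs_add_pow_sub_le (2 * j) T u)).2
  push_cast at hmain
  have hsplit : (2 * (j : ℝ) + 2) * T ^ (2 * j + 1) * u =
      (2 * (j : ℝ) + 2) * T ^ (2 * j + 1) * (A⁻¹ * p * h) -
        ((2 * j + 2) * T ^ (2 * j + 1) * (A⁻¹ * p * g)) * v := by rw [hu]; ring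
  rw [hsplit] at hmain
  rw [div_eq_mul_inv (p ^ 2), div_eq_mul_inv _ (D ^ 2), ← inv_pow, ← hw]
  linarith

/-- Here `n = |A * T|` and `t = |T|`, so `n` is of order `D * t`. For `t ≤ ε` the cubic term and, by
completing a square, the quadratic one each cost at most half of `n ^ 4 / D`, up to a multiple of
`D`. For `t > ε` every power of `t` up to 8 is dominated by `(t / ε) ^ m`, and this goes into `D ^ 3
* t ^ m`. -/
lemma exists_fourth_power_balance {a₁ a₂ a₃ κ K : ℝ} (h₁ : 0 ≤ a₁) (h₂ : 0 ≤ a₂) (h₃ : 0 ≤ a₃)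
    (hκ : 0 < κ) (hK : 0 ≤ K) {m : ℕ} (hm : 8 ≤ m) :
    ∃ C, 0 ≤ C ∧ ∀ n t D : ℝ, 0 ≤ t → 1 ≤ D → κ * D * t ≤ n → n ≤ K * D * t →
      a₁ * n ^ 3 * t ^ 2 + a₂ * n ^ 2 * (1 + t ^ 4) + a₃ * (1 + t ^ 8) ≤
        n ^ 4 / D + C * D + C * D ^ 3 * t ^ m := by
  set ε : ℝ := min 1 (κ / (2 * (a₁ + 1))) with hε
  have hε0 : 0 < ε := by positivity
  have hε1 : ε ≤ 1 := min_le_left _ _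
  have hε2 : a₁ * ε ≤ κ / 2 := by
    have h4 : ε ≤ κ / (2 * (a₁ + 1)) := min_le_right _ _
    rw [le_div_iff₀ (by positivity)] at h4
    linarith
  set C₁ := 2 * a₂ ^ 2 + 2 * a₃
  set C₂ := (a₁ * K ^ 3 + 2 * a₂ * K ^ 2 + 2 * a₃) / ε ^ m with hC₂
  have hC₁0 : 0 ≤ C₁ := by positivity
  have hC₂0 : 0 ≤ C₂ := by positivity
  refine ⟨C₁ + C₂, by positivity, fun n t D ht hD hn1 hn2 => ?_⟩
  have hD0 : 0 < D := by linarith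
  have hn : 0 ≤ n := le_trans (by positivity) hn1
  have hr : 0 ≤ (C₁ + C₂) * D ^ 3 * t ^ m := by positivity
  have hr2 : 0 ≤ (C₁ + C₂) * D := by positivity
  have hr3 : 0 ≤ n ^ 4 / D := by positivity
  rcases le_or_gt t ε with h | h
  · have ht1 : t ≤ 1 := h.trans hε1
    have e1 : a₁ * n ^ 3 * t ^ 2 ≤ n ^ 4 / D / 2 := by
      rw [div_div, le_div_iff₀ (by positivity)]
      have h5 : a₁ * t ≤ κ / 2 := (mul_le_mul_of_nonneg_left h h₁).trans hε2
      calc a₁ * n ^ 3 * t ^ 2 * (D * 2) = (a₁ * t) * (2 * n ^ 3 * D * t) := by ring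
        _ ≤ κ / 2 * (2 * n ^ 3 * D * t) := by gcongr
        _ = n ^ 3 * (κ * D * t) := by ring
        _ ≤ n ^ 3 * n := by gcongr
        _ = n ^ 4 := by ring
    have e2 : a₂ * n ^ 2 * 2 ≤ n ^ 4 / D / 2 + 2 * a₂ ^ 2 * D := by
      have h6 : n ^ 4 / D / 2 + 2 * a₂ ^ 2 * D - a₂ * n ^ 2 * 2 =
          (n ^ 2 - 2 * a₂ * D) ^ 2 / (2 * D) := by field_simp; ring
      have h7 : 0 ≤ (n ^ 2 - 2 * a₂ * D) ^ 2 / (2 * D) := by positivity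
      linarith
    have t4 : 1 + t ^ 4 ≤ 2 := by linarith [pow_le_one₀ ht ht1 (n := 4)]
    have t8 : 1 + t ^ 8 ≤ 2 := by linarith [pow_le_one₀ ht ht1 (n := 8)]
    have e3 : a₂ * n ^ 2 * (1 + t ^ 4) ≤ a₂ * n ^ 2 * 2 := by gcongr
    have e4 : a₃ * (1 + t ^ 8) ≤ 2 * a₃ * D := by
      calc a₃ * (1 + t ^ 8) ≤ a₃ * 2 := by gcongr
        _ ≤ 2 * a₃ * D := by linarith [mul_le_mul_of_nonneg_left hD h₃]
    have e5 : C₁ * D ≤ (C₁ + C₂) * D := by gcongr; linarith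
    have e6 : C₁ * D = 2 * a₂ ^ 2 * D + 2 * a₃ * D := by ring
    linarith
  · have key : ∀ i ≤ 8, t ^ i ≤ t ^ m / ε ^ m := fun i hi => by
      have hy : 1 ≤ t / ε := (one_le_div hε0).2 h.le
      calc t ^ i = ε ^ i * (t / ε) ^ i := by rw [← mul_pow]; congr 1; field_simp
        _ ≤ 1 * (t / ε) ^ m := by
            gcongr
            · exact pow_le_one₀ hε0.le hε1
            · omega
        _ = _ := by rw [one_mul, div_pow]
    have hD23 : D ^ 2 ≤ D ^ 3 := pow_le_pow_right₀ hD (by norm_num)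
    have hD3 : 1 ≤ D ^ 3 := one_le_pow₀ hD
    have hY : 0 ≤ t ^ m / ε ^ m := by positivity
    have f1 : a₁ * n ^ 3 * t ^ 2 ≤ a₁ * K ^ 3 * D ^ 3 * (t ^ m / ε ^ m) := by
      calc a₁ * n ^ 3 * t ^ 2 ≤ a₁ * (K * D * t) ^ 3 * t ^ 2 := by gcongr
        _ = a₁ * K ^ 3 * D ^ 3 * t ^ 5 := by ring
        _ ≤ _ := by gcongr; exact key 5 (by norm_num)
    have f2 : a₂ * n ^ 2 * (1 + t ^ 4) ≤ 2 * a₂ * K ^ 2 * D ^ 3 * (t ^ m / ε ^ m) := by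
      calc a₂ * n ^ 2 * (1 + t ^ 4) ≤ a₂ * (K * D * t) ^ 2 * (1 + t ^ 4) := by gcongr
        _ = a₂ * K ^ 2 * D ^ 2 * (t ^ 2 + t ^ 6) := by ring
        _ ≤ a₂ * K ^ 2 * D ^ 3 * (t ^ m / ε ^ m + t ^ m / ε ^ m) := by
            gcongr
            · exact key 2 (by norm_num)
            · exact key 6 (by norm_num)
        _ = _ := by ring
    have f3 : a₃ * (1 + t ^ 8) ≤ 2 * a₃ * D ^ 3 * (t ^ m / ε ^ m) := by
      have k0 := key 0 (by norm_num)
      rw [pow_zero] at k0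
      calc a₃ * (1 + t ^ 8) ≤ a₃ * (t ^ m / ε ^ m + t ^ m / ε ^ m) := by
            gcongr; exact key 8 (by norm_num)
        _ = 2 * a₃ * 1 * (t ^ m / ε ^ m) := by ring
        _ ≤ _ := by gcongr
    have f4 : C₂ * D ^ 3 * t ^ m = a₁ * K ^ 3 * D ^ 3 * (t ^ m / ε ^ m) +
        2 * a₂ * K ^ 2 * D ^ 3 * (t ^ m / ε ^ m) + 2 * a₃ * D ^ 3 * (t ^ m / ε ^ m) := by
      rw [hC₂]; ring
    have f5 : C₂ * D ^ 3 * t ^ m ≤ (C₁ + C₂) * D ^ 3 * t ^ m := by gcongr; linarith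
    linarith

lemma increment_bounds {K B T p h g v b : ℝ} (hK : 1 ≤ K) (hp : |p| ≤ B) (hv : |v| ≤ 1)
    (hg : |g| ≤ K * (1 + |p * T|)) (hb : |b * (p * T) + h| ≤ K * (p * T) ^ 2) :
    |p * (b * (p * T) + h)| ≤ B * K * p ^ 2 * T ^ 2 ∧
    (p * (b * (p * T) + h)) ^ 2 ≤ p ^ 2 * (K ^ 2 * B ^ 4 * T ^ 4) ∧
    (p * (b * (p * T) + h) - p * g * v) ^ 2 ≤ p ^ 2 * (K ^ 2 * (6 + 4 * B ^ 4) * (1 + T ^ 4)) := by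
  have hB : 0 ≤ B := (abs_nonneg p).trans hp
  have hpB : p ^ 2 ≤ B ^ 2 := sq_le_sq' (by linarith [neg_abs_le p]) ((le_abs_self p).trans hp)
  have hpT : (p * T) ^ 2 ≤ B ^ 2 * T ^ 2 := by
    rw [mul_pow]; exact mul_le_mul_of_nonneg_right hpB (sq_nonneg T)
  have h1 : |p * (b * (p * T) + h)| ≤ B * K * p ^ 2 * T ^ 2 := by
    rw [abs_mul]
    calc |p| * |b * (p * T) + h| ≤ B * (K * (p * T) ^ 2) := by gcongr
      _ = _ := by ring
  have h2 : (b * (p * T) + h) ^ 2 ≤ K ^ 2 * B ^ 4 * T ^ 4 := by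
    rw [← sq_abs]
    calc |b * (p * T) + h| ^ 2 ≤ (K * (B ^ 2 * T ^ 2)) ^ 2 := by
          gcongr; exact hb.trans (by gcongr)
      _ = _ := by ring
  have h3 : (p * (b * (p * T) + h)) ^ 2 ≤ p ^ 2 * (K ^ 2 * B ^ 4 * T ^ 4) := by
    rw [mul_pow]; gcongr
  have h4 : (g * v) ^ 2 ≤ K ^ 2 * (3 + B ^ 4 * T ^ 4) := by
    have h5 : |g * v| ≤ K * (1 + |p * T|) := by
      rw [abs_mul]; exact (mul_le_of_le_one_right (abs_nonneg g) hv).trans hg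
    rw [← sq_abs]
    calc |g * v| ^ 2 ≤ (K * (1 + |p * T|)) ^ 2 := by gcongr
      _ = K ^ 2 * (1 + |p * T|) ^ 2 := by ring
      _ ≤ _ := by
        gcongr
        linarith [sq_nonneg (1 - |p * T|), sq_abs (p * T), sq_nonneg (B ^ 2 * T ^ 2 - 1)]
  refine ⟨h1, h3, ?_⟩
  calc (p * (b * (p * T) + h) - p * g * v) ^ 2
      ≤ 2 * (p * (b * (p * T) + h)) ^ 2 + 2 * (p ^ 2 * (g * v) ^ 2) := by
        linarith [sq_nonneg (p * (b * (p * T) + h) + p * g * v)]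
    _ ≤ 2 * (p ^ 2 * (K ^ 2 * B ^ 4 * T ^ 4)) + 2 * (p ^ 2 * (K ^ 2 * (3 + B ^ 4 * T ^ 4))) := by
        gcongr
    _ = p ^ 2 * (K ^ 2 * (6 + 4 * B ^ 4 * T ^ 4)) := by ring
    _ ≤ p ^ 2 * (K ^ 2 * ((6 + 4 * B ^ 4) * (1 + T ^ 4))) := by
        gcongr
        have h6 : 0 ≤ B ^ 4 := by positivity
        have h7 : 0 ≤ T ^ 4 := by positivity
        linarith
    _ = _ := by ring

/-- One-step estimate for the fourth power of the normalised estimation error `A T`. -/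
lemma exists_fourth_power_step {c K : ℝ} (hc : 0 < c) (hK : 1 ≤ K) (B : ℝ) {m : ℕ} (hm : 8 ≤ m)
    (hme : Even m) :
    ∃ C, 0 ≤ C ∧ ∀ T p h g v b A D₀ D : ℝ, 1 ≤ D₀ → D = D₀ + p ^ 2 → |p| ≤ B → c * D₀ ≤ A →
      A ≤ K * D₀ → |v| ≤ 1 → |g| ≤ K * (1 + |p * T|) → |b * (p * T) + h| ≤ K * (p * T) ^ 2 →
      (A * T + (p * (b * (p * T) + h) - p * g * v)) ^ 4 ≤
        (1 + p ^ 2 / D) * (A * T) ^ 4 + C * p ^ 2 * D + C * p ^ 2 * D ^ 3 * T ^ m -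
          (4 * (A * T) ^ 3 * p * g) * v := by
  by_cases hB : 0 ≤ B
  swap
  · refine ⟨0, le_rfl, fun T p h g v b A D₀ D _ _ hp => ?_⟩
    exact absurd ((abs_nonneg p).trans hp) hB
  set K3 := K ^ 2 * (6 + 4 * B ^ 4) with hK3
  obtain ⟨C, hC, H⟩ := exists_fourth_power_balance (a₁ := 4 * B * K) (a₂ := 8 * K3)
    (a₃ := 6 * K3 ^ 2 * B ^ 2) (κ := c / (1 + B ^ 2)) (K := K) (by positivity) (by positivity)
    (by positivity) (by positivity) (by positivity) hm
  refine ⟨C, hC, fun T p h g v b A D₀ D hD₀ hD hp hA1 hA2 hv hg hb => ?_⟩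
  obtain ⟨i1, -, i3⟩ := increment_bounds hK hp hv hg hb
  have hpB : p ^ 2 ≤ B ^ 2 := sq_le_sq' (by linarith [neg_abs_le p]) ((le_abs_self p).trans hp)
  have hD1 : 1 ≤ D := by linarith [sq_nonneg p]
  have hA0 : 0 ≤ A := le_trans (by positivity) hA1
  have hDD : D ≤ (1 + B ^ 2) * D₀ := by
    have := mul_le_mul_of_nonneg_left hD₀ (sq_nonneg B)
    linarith
  have hab : |A * T| = A * |T| := by rw [abs_mul, abs_of_nonneg hA0]
  have hb1 : c / (1 + B ^ 2) * D * |T| ≤ |A * T| := by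
    rw [hab]; gcongr
    refine le_trans ?_ hA1
    rw [div_mul_eq_mul_div, div_le_iff₀ (by positivity)]
    linarith [mul_le_mul_of_nonneg_left hDD hc.le]
  have hb2 : |A * T| ≤ K * D * |T| := by
    rw [hab]; gcongr
    exact hA2.trans (by gcongr; linarith [sq_nonneg p])
  have hbal := H |A * T| |T| D (abs_nonneg _) hD1 hb1 hb2
  have q2 : |A * T| ^ 2 = (A * T) ^ 2 := sq_abs _
  have q4 : |A * T| ^ 4 = (A * T) ^ 4 := Even.pow_abs (by decide) _
  have t2 : |T| ^ 2 = T ^ 2 := sq_abs _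
  have t4 : |T| ^ 4 = T ^ 4 := Even.pow_abs (by decide) _
  have t8 : |T| ^ 8 = T ^ 8 := Even.pow_abs (by decide) _
  have tm : |T| ^ m = T ^ m := hme.pow_abs _
  rw [q2, q4, t2, t4, t8, tm] at hbal
  generalize hη : A * T = η at *
  generalize hr : p * (b * (p * T) + h) = r at *
  set s := r - p * g * v with hs
  -- The difference of the two sides is `2 * s ^ 2 * (η - s) ^ 2`.
  have e1 : (η + s) ^ 4 ≤ η ^ 4 + 4 * η ^ 3 * s + 8 * η ^ 2 * s ^ 2 + 3 * (s ^ 2) ^ 2 := by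
    linarith [mul_nonneg (sq_nonneg s) (sq_nonneg (η - s))]
  have e2 : 4 * η ^ 3 * r ≤ p ^ 2 * (4 * B * K * |η| ^ 3 * T ^ 2) := by
    calc 4 * η ^ 3 * r ≤ |4 * η ^ 3 * r| := le_abs_self _
      _ = 4 * |η| ^ 3 * |r| := by rw [abs_mul, abs_mul, abs_pow]; norm_num
      _ ≤ 4 * |η| ^ 3 * (B * K * p ^ 2 * T ^ 2) := by gcongr
      _ = _ := by ring
  have e3 : 8 * η ^ 2 * s ^ 2 ≤ p ^ 2 * (8 * K3 * η ^ 2 * (1 + T ^ 4)) := by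
    calc 8 * η ^ 2 * s ^ 2 ≤ 8 * η ^ 2 * (p ^ 2 * (K3 * (1 + T ^ 4))) := by gcongr
      _ = _ := by ring
  have e4 : 3 * (s ^ 2) ^ 2 ≤ p ^ 2 * (6 * K3 ^ 2 * B ^ 2 * (1 + T ^ 8)) := by
    calc 3 * (s ^ 2) ^ 2 ≤ 3 * (p ^ 2 * (K3 * (1 + T ^ 4))) ^ 2 := by gcongr
      _ = p ^ 2 * (3 * K3 ^ 2 * p ^ 2 * (1 + T ^ 4) ^ 2) := by ring
      _ ≤ p ^ 2 * (3 * K3 ^ 2 * B ^ 2 * (2 * (1 + T ^ 8))) := by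
          gcongr
          linarith [sq_nonneg (1 - T ^ 4)]
      _ = _ := by ring
  have e5 := mul_le_mul_of_nonneg_left hbal (sq_nonneg p)
  have e6 : p ^ 2 * (η ^ 4 / D + C * D + C * D ^ 3 * T ^ m) =
      p ^ 2 / D * η ^ 4 + C * p ^ 2 * D + C * p ^ 2 * D ^ 3 * T ^ m := by ring
  have e7 : 4 * η ^ 3 * s = 4 * η ^ 3 * r - (4 * η ^ 3 * p * g) * v := by rw [hs]; ring
  linarith

lemma pow_le_one_add_pow_four {t : ℝ} (ht : 0 ≤ t) {i : ℕ} (hi : i ≤ 4) : t ^ i ≤ 1 + t ^ 4 := by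
  rcases le_total t 1 with h | h
  · linarith [pow_le_one₀ ht h (n := i), pow_nonneg ht 4]
  · linarith [pow_le_pow_right₀ h hi]

/-- The natural scale is `T ~ D ^ (-1/2)`: in the variable `√D * |T|` each quantity, multiplied by
`√D`, is at most a power of degree at most 4. -/
lemma moment_bounds {T D : ℝ} (hD : 1 ≤ D) :
    |T| ≤ (1 + D ^ 2 * T ^ 4) / √D ∧ T ^ 2 ≤ (1 + D ^ 2 * T ^ 4) / √D ∧
    T ^ 4 ≤ (1 + D ^ 2 * T ^ 4) / √D ∧ D * |T| ^ 3 ≤ (1 + D ^ 2 * T ^ 4) / √D := by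
  obtain ⟨ρ, hρ⟩ : ∃ ρ, ρ = √D := ⟨_, rfl⟩
  have hρ1 : 1 ≤ ρ := by rw [hρ]; exact Real.one_le_sqrt.2 hD
  have hD2 : D = ρ ^ 2 := by rw [hρ, Real.sq_sqrt (by linarith)]
  rw [← hρ, hD2]
  have ht : 0 ≤ ρ * |T| := by positivity
  have h4 : (ρ ^ 2) ^ 2 * T ^ 4 = (ρ * |T|) ^ 4 := by
    rw [mul_pow, Even.pow_abs (by decide)]; ring
  have hT2 : T ^ 2 = |T| ^ 2 := (sq_abs T).symm
  have hT4 : T ^ 4 = |T| ^ 4 := (Even.pow_abs (by decide) T).symm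
  rw [h4]
  have hρ0 : 0 < ρ := by linarith
  have h1 : ∀ i : ℕ, 1 ≤ i → ρ ≤ ρ ^ i := fun i hi => le_self_pow₀ hρ1 (by omega)
  refine ⟨?_, ?_, ?_, ?_⟩ <;> rw [le_div_iff₀ hρ0]
  · calc |T| * ρ = (ρ * |T|) ^ 1 := by ring
      _ ≤ _ := pow_le_one_add_pow_four ht (by norm_num)
  · calc T ^ 2 * ρ ≤ T ^ 2 * ρ ^ 2 := by gcongr; exact h1 2 (by norm_num)
      _ = (ρ * |T|) ^ 2 := by rw [hT2]; ring
      _ ≤ _ := pow_le_one_add_pow_four ht (by norm_num)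
  · calc T ^ 4 * ρ ≤ T ^ 4 * ρ ^ 4 := by gcongr; exact h1 4 (by norm_num)
      _ = (ρ * |T|) ^ 4 := by rw [hT4]; ring
      _ ≤ _ := pow_le_one_add_pow_four ht (by norm_num)
  · calc ρ ^ 2 * |T| ^ 3 * ρ = (ρ * |T|) ^ 3 := by ring
      _ ≤ _ := pow_le_one_add_pow_four ht (by norm_num)

/-- One-step expansion of the square of the normalised estimation error `A T`. -/
lemma exists_square_step {c K : ℝ} (hc : 0 < c) (hK : 1 ≤ K) {B : ℝ} (hB : 0 ≤ B) :
    ∃ C, 0 ≤ C ∧ ∀ T p h g v b A D₀ D V w β : ℝ, 1 ≤ D₀ → D = D₀ + p ^ 2 → |p| ≤ B →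
      c * D₀ ≤ A → A ≤ K * D₀ → |v| ≤ 1 → |g| ≤ K * (1 + |p * T|) →
      |b * (p * T) + h| ≤ K * (p * T) ^ 2 → v ^ 2 = V + w * v →
      |g ^ 2 * V - β| ≤ K * (|p * T| + (p * T) ^ 2) →
      ∃ Q, (A * T + (p * (b * (p * T) + h) - p * g * v)) ^ 2 =
        (A * T) ^ 2 + p ^ 2 * β + Q + (p ^ 2 * g ^ 2 * w -
          2 * (A * T + p * (b * (p * T) + h)) * p * g) * v ∧
        |Q| ≤ C * (p ^ 2 / √D) * (1 + D ^ 2 * T ^ 4) := by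
  refine ⟨2 * K * (B * K) + K ^ 2 * B ^ 4 + K * B + K * B ^ 2, by positivity, ?_⟩
  intro T p h g v b A D₀ D V w β hD₀ hD hp hA1 hA2 hv hg hb hvv hgV
  obtain ⟨i1, i2, -⟩ := increment_bounds hK hp hv hg hb
  have hD1 : 1 ≤ D := by linarith [sq_nonneg p]
  obtain ⟨m1, m2, m4, m3⟩ := moment_bounds (T := T) hD1
  have hA0 : 0 ≤ A := le_trans (by positivity) hA1
  have hpB : p ^ 2 ≤ B ^ 2 := sq_le_sq' (by linarith [neg_abs_le p]) ((le_abs_self p).trans hp)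
  generalize hr : p * (b * (p * T) + h) = r at *
  refine ⟨2 * (A * T) * r + r ^ 2 + p ^ 2 * (g ^ 2 * V - β), ?_, ?_⟩
  · linear_combination (p ^ 2 * g ^ 2) * hvv
  · have hR : 0 ≤ (1 + D ^ 2 * T ^ 4) / √D := by positivity
    set R := (1 + D ^ 2 * T ^ 4) / √D with hRdef
    have f1 : |2 * (A * T) * r| ≤ p ^ 2 * (2 * K * (B * K) * R) := by
      rw [abs_mul, abs_mul, abs_mul, abs_of_nonneg hA0]
      calc |(2 : ℝ)| * (A * |T|) * |r| ≤ 2 * (K * D * |T|) * (B * K * p ^ 2 * T ^ 2) := by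
            rw [abs_of_pos (by norm_num : (0 : ℝ) < 2)]
            gcongr
            exact hA2.trans (by gcongr; linarith [sq_nonneg p])
        _ = p ^ 2 * (2 * K * (B * K) * (D * |T| ^ 3)) := by rw [← sq_abs T]; ring
        _ ≤ _ := by gcongr
    have f2 : r ^ 2 ≤ p ^ 2 * (K ^ 2 * B ^ 4 * R) := i2.trans (by gcongr)
    have f3 : |p ^ 2 * (g ^ 2 * V - β)| ≤ p ^ 2 * (K * B * R + K * B ^ 2 * R) := by
      rw [abs_mul, abs_of_nonneg (sq_nonneg p)]
      gcongr
      calc _ ≤ _ := hgV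
        _ ≤ K * (B * |T| + B ^ 2 * T ^ 2) := by
            rw [abs_mul, mul_pow]; gcongr
        _ ≤ K * (B * R + B ^ 2 * R) := by gcongr
        _ = _ := by ring
    have f4 := abs_add_le (2 * (A * T) * r + r ^ 2) (p ^ 2 * (g ^ 2 * V - β))
    have f5 := abs_add_le (2 * (A * T) * r) (r ^ 2)
    rw [abs_of_nonneg (sq_nonneg r)] at f5
    calc _ ≤ p ^ 2 * (2 * K * (B * K) * R) + p ^ 2 * (K ^ 2 * B ^ 4 * R) +
          p ^ 2 * (K * B * R + K * B ^ 2 * R) := by linarith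
      _ = _ := by rw [hRdef]; ring

/-- One-step estimate for the squared difference between the random and the true information. -/
lemma exists_information_step {K B : ℝ} (hK : 1 ≤ K) (hB : 0 ≤ B) :
    ∃ C, 0 ≤ C ∧ ∀ T p b β G D : ℝ, 1 ≤ D → |p| ≤ B → |b - β| ≤ K * |p * T| → |G| ≤ 2 * K * D →
      (G + p ^ 2 * (b - β)) ^ 2 ≤ G ^ 2 + C * (p ^ 2 * √D) * (1 + D ^ 2 * T ^ 4) := by
  refine ⟨4 * K ^ 2 * B + B ^ 4 * K ^ 2, by positivity, fun T p b β G D hD hp hb hG => ?_⟩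
  obtain ⟨m1, m2, -, -⟩ := moment_bounds (T := T) hD
  have hpB : p ^ 2 ≤ B ^ 2 := sq_le_sq' (by linarith [neg_abs_le p]) ((le_abs_self p).trans hp)
  have hb' : |b - β| ≤ K * B * |T| := by
    refine hb.trans ?_
    rw [abs_mul, ← mul_assoc]; gcongr
  have hs : 1 ≤ √D := Real.one_le_sqrt.2 hD
  have hDs : D / √D = √D := Real.div_sqrt
  have f1 : G * (b - β) ≤ 2 * K ^ 2 * B * (√D * (1 + D ^ 2 * T ^ 4)) := by
    calc G * (b - β) ≤ |G * (b - β)| := le_abs_self _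
      _ = |G| * |b - β| := abs_mul _ _
      _ ≤ 2 * K * D * (K * B * |T|) := by gcongr
      _ ≤ 2 * K * D * (K * B * ((1 + D ^ 2 * T ^ 4) / √D)) := by gcongr
      _ = 2 * K ^ 2 * B * (D / √D * (1 + D ^ 2 * T ^ 4)) := by ring
      _ = _ := by rw [hDs]
  have f2 : (b - β) ^ 2 ≤ K ^ 2 * B ^ 2 * (√D * (1 + D ^ 2 * T ^ 4)) := by
    rw [← sq_abs]
    calc |b - β| ^ 2 ≤ (K * B * |T|) ^ 2 := by gcongr
      _ = K ^ 2 * B ^ 2 * T ^ 2 := by rw [← sq_abs T]; ring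
      _ ≤ K ^ 2 * B ^ 2 * (√D * (1 + D ^ 2 * T ^ 4)) := by
          gcongr
          refine m2.trans ?_
          have : 0 ≤ 1 + D ^ 2 * T ^ 4 := by positivity
          exact (div_le_self this hs).trans (le_mul_of_one_le_left this hs)
  calc (G + p ^ 2 * (b - β)) ^ 2 = G ^ 2 + p ^ 2 * (2 * (G * (b - β)) + p ^ 2 * (b - β) ^ 2) := by
        ring
    _ ≤ G ^ 2 + p ^ 2 * (2 * (2 * K ^ 2 * B * (√D * (1 + D ^ 2 * T ^ 4))) +
          B ^ 2 * (K ^ 2 * B ^ 2 * (√D * (1 + D ^ 2 * T ^ 4)))) := by gcongr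
    _ = _ := by ring

/-! ### Deterministic recursions driven by the cumulated squared inputs. -/

/-- Cumulated squared inputs, with unit initial value. -/
def gram (p : ℕ → ℝ) (k : ℕ) : ℝ := 1 + ∑ i ∈ Finset.range k, p i ^ 2

lemma gram_succ (p : ℕ → ℝ) (k : ℕ) : gram p (k + 1) = gram p k + p k ^ 2 := by
  simp only [gram, Finset.sum_range_succ]; ring

lemma one_le_gram (p : ℕ → ℝ) (k : ℕ) : 1 ≤ gram p k := by
  have : 0 ≤ ∑ i ∈ Finset.range k, p i ^ 2 := Finset.sum_nonneg fun i _ => sq_nonneg _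
  simp only [gram]; linarith

lemma gram_pos (p : ℕ → ℝ) (k : ℕ) : 0 < gram p k := zero_lt_one.trans_le (one_le_gram p k)

lemma gram_mono (p : ℕ → ℝ) : Monotone (gram p) :=
  monotone_nat_of_le_succ fun k => by rw [gram_succ]; linarith [sq_nonneg (p k)]

lemma ratio_mem (p : ℕ → ℝ) (k : ℕ) :
    0 ≤ p k ^ 2 / gram p (k + 1) ∧ p k ^ 2 / gram p (k + 1) < 1 ∧
      gram p k = gram p (k + 1) * (1 - p k ^ 2 / gram p (k + 1)) := by
  have h := gram_pos p (k + 1)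
  have h0 := gram_pos p k
  refine ⟨by positivity, ?_, ?_⟩
  · rw [div_lt_one h, gram_succ]; linarith
  · rw [mul_sub, mul_one, mul_div_cancel₀ _ h.ne', gram_succ]; ring

/-- With `x = p k ^ 2 / gram p (k + 1)`, the loss in passing from `gram p k` to `gram p (k + 1)` is
`(1 - x) ^ (-2)`. The contraction `1 - 5 * x` is below `(1 - x) ^ 3`, leaving a surplus `x * K / D ^
2` that pays for the forcing term. The finitely many indices up to `k₀` are absorbed in `K`. -/
lemma exists_le_div_gram_sq {p M : ℕ → ℝ} {C : ℝ} {k₀ : ℕ} (hC : 0 ≤ C)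
    (hx : ∀ k ≥ k₀, 5 * (p k ^ 2 / gram p (k + 1)) ≤ 1)
    (h : ∀ k ≥ k₀, M (k + 1) ≤ (1 - 5 * (p k ^ 2 / gram p (k + 1))) * M k +
      C * (p k ^ 2 / gram p (k + 1)) / gram p (k + 1) ^ 2) :
    ∃ K, 0 ≤ K ∧ ∀ k, M k ≤ K / gram p k ^ 2 := by
  set K := C + ∑ i ∈ Finset.range (k₀ + 1), |M i| * gram p i ^ 2 with hK
  have hnn : ∀ i ∈ Finset.range (k₀ + 1), 0 ≤ |M i| * gram p i ^ 2 := fun i _ => by positivity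
  have hCK : C ≤ K := le_add_of_nonneg_right (Finset.sum_nonneg hnn)
  have hsmall : ∀ k ≤ k₀, M k ≤ K / gram p k ^ 2 := fun k hk => by
    rw [le_div_iff₀ (pow_pos (gram_pos p k) 2)]
    have h1 := Finset.single_le_sum hnn (Finset.mem_range.2 (Nat.lt_succ_of_le hk))
    have h2 : M k * gram p k ^ 2 ≤ |M k| * gram p k ^ 2 := by gcongr; exact le_abs_self _
    linarith
  refine ⟨K, hC.trans hCK, fun k => ?_⟩
  rcases le_total k k₀ with hk | hk
  · exact hsmall k hk
  induction k, hk using Nat.le_induction with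
  | base => exact hsmall k₀ le_rfl
  | succ k hk ih =>
    have hs := h k hk
    have hx5 := hx k hk
    obtain ⟨x0, x1, hD⟩ := ratio_mem p k
    rw [hD] at ih
    have hD' := gram_pos p (k + 1)
    generalize p k ^ 2 / gram p (k + 1) = x at *
    generalize gram p (k + 1) = D at *
    have hy : 0 < 1 - x := by linarith
    have e1 : (1 - 5 * x) * M k ≤ (1 - 5 * x) * (K / (D * (1 - x)) ^ 2) :=
      mul_le_mul_of_nonneg_left ih (by linarith)
    have e2 : (1 - 5 * x) * (K / (D * (1 - x)) ^ 2) ≤ (1 - x) * (K / D ^ 2) := by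
      have e3 : (1 - 5 * x) / (1 - x) ^ 2 ≤ 1 - x := by
        rw [div_le_iff₀ (by positivity)]
        nlinarith [sq_nonneg x, mul_nonneg x0 (sq_nonneg (1 - x))]
      have e4 : 0 ≤ K / D ^ 2 := div_nonneg (hC.trans hCK) (by positivity)
      calc _ = (1 - 5 * x) / (1 - x) ^ 2 * (K / D ^ 2) := by field_simp
        _ ≤ _ := by gcongr
    have e5 : C * x / D ^ 2 ≤ x * (K / D ^ 2) := by
      rw [mul_comm C x, mul_div_assoc]; gcongr
    linarith

/-- The inequality `(1 + x) * (1 - x) ^ 2 ≤ 1 - x` says that quadratic growth of the bound outpaces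
the factor `1 + x`, again with a surplus `x` for the forcing term. -/
lemma exists_le_mul_gram_sq {p N : ℕ → ℝ} {C : ℝ} (hC : 0 ≤ C)
    (h : ∀ k, N (k + 1) ≤ (1 + p k ^ 2 / gram p (k + 1)) * N k + C * p k ^ 2 * gram p (k + 1)) :
    ∃ K, 0 ≤ K ∧ ∀ k, N k ≤ K * gram p k ^ 2 := by
  have hK0 : 0 ≤ C + |N 0| := by positivity
  refine ⟨C + |N 0|, hK0, fun k => ?_⟩
  induction k with
  | zero => simp only [gram, Finset.range_zero, Finset.sum_empty]; linarith [le_abs_self (N 0)]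
  | succ k ih =>
    have hs := h k
    obtain ⟨x0, x1, hD⟩ := ratio_mem p k
    have hD' := gram_pos p (k + 1)
    rw [hD] at ih
    have hp' : C * p k ^ 2 * gram p (k + 1) =
        C * (p k ^ 2 / gram p (k + 1)) * gram p (k + 1) ^ 2 := by field_simp
    rw [hp'] at hs
    clear hp' hD
    have hCK : C ≤ C + |N 0| := by linarith [abs_nonneg (N 0)]
    generalize C + |N 0| = K at *
    generalize p k ^ 2 / gram p (k + 1) = x at *
    generalize gram p (k + 1) = D at *
    have e1 : (1 + x) * N k ≤ (1 + x) * (K * (D * (1 - x)) ^ 2) :=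
      mul_le_mul_of_nonneg_left ih (by linarith)
    have e2 : (1 + x) * (K * (D * (1 - x)) ^ 2) ≤ (1 - x) * (K * D ^ 2) := by
      have e3 : (1 + x) * (1 - x) ^ 2 ≤ 1 - x := by
        nlinarith [mul_nonneg (sq_nonneg x) (sub_nonneg.2 x1.le)]
      calc _ = (1 + x) * (1 - x) ^ 2 * (K * D ^ 2) := by ring
        _ ≤ _ := by gcongr
    have e4 : C * x * D ^ 2 ≤ x * (K * D ^ 2) := by
      calc C * x * D ^ 2 = x * (C * D ^ 2) := by ring
        _ ≤ _ := by gcongr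
    linarith

lemma abs_sub_sum_le_mul_sqrt_gram {p a i : ℕ → ℝ} {C : ℝ} (hC : 0 ≤ C)
    (h : ∀ k, |a (k + 1) - a k - i k| ≤ C * (p k ^ 2 / √(gram p (k + 1)))) (k : ℕ) :
    |a k - a 0 - ∑ l ∈ Finset.range k, i l| ≤ 2 * C * √(gram p k) := by
  induction k with
  | zero => simp; positivity
  | succ k ih =>
    rw [Finset.sum_range_succ]
    -- Factor `p k ^ 2` as a difference of squares of the two square roots; the sum of the roots is
    -- at most twice the larger one. The bound telescopes.
    have h1 : p k ^ 2 / √(gram p (k + 1)) ≤ 2 * (√(gram p (k + 1)) - √(gram p k)) := by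
      have s1 := Real.sq_sqrt (gram_pos p (k + 1)).le
      have s0 := Real.sq_sqrt (gram_pos p k).le
      have hle : √(gram p k) ≤ √(gram p (k + 1)) := Real.sqrt_le_sqrt (gram_mono p k.le_succ)
      rw [div_le_iff₀ (Real.sqrt_pos.2 (gram_pos p (k + 1)))]
      have hs := gram_succ p k
      nlinarith [sq_nonneg (√(gram p (k + 1)) - √(gram p k))]
    calc |a (k + 1) - a 0 - (∑ l ∈ Finset.range k, i l + i k)|
        = |(a k - a 0 - ∑ l ∈ Finset.range k, i l) + (a (k + 1) - a k - i k)| := by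
          congr 1; ring
      _ ≤ 2 * C * √(gram p k) + C * (2 * (√(gram p (k + 1)) - √(gram p k))) :=
          (abs_add_le _ _).trans (add_le_add ih ((h k).trans (by gcongr)))
      _ = _ := by ring

lemma le_add_mul_gram_mul_sqrt {p a : ℕ → ℝ} {C : ℝ} (hC : 0 ≤ C)
    (h : ∀ k, a (k + 1) ≤ a k + C * (p k ^ 2 * √(gram p (k + 1)))) (k : ℕ) :
    a k ≤ a 0 + C * (gram p k * √(gram p k)) := by
  induction k with
  | zero =>
    have : 0 ≤ C * (gram p 0 * √(gram p 0)) :=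
      mul_nonneg hC (mul_nonneg (gram_pos p 0).le (Real.sqrt_nonneg _))
    linarith
  | succ k ih =>
    have hle : gram p k * √(gram p k) ≤ gram p k * √(gram p (k + 1)) :=
      mul_le_mul_of_nonneg_left (Real.sqrt_le_sqrt (gram_mono p k.le_succ)) (gram_pos p k).le
    calc a (k + 1) ≤ a 0 + C * (gram p k * √(gram p (k + 1))) +
          C * (p k ^ 2 * √(gram p (k + 1))) := by
            linarith [h k, mul_le_mul_of_nonneg_left hle hC]
      _ = _ := by rw [gram_succ]; ring

/-! ### Moments of the abstract error recursion. -/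

/-- Stochastic recursion satisfied by the estimation error `T` and the inverse gain `A`. The data
`s` are independent binary variables with means `F`, the input is `p`, the true Fisher weights are
`β`; `h` is the conditional mean of the innovation, `g` its sensitivity to the data and `b` the
estimated Fisher weight. -/
structure ErrorRecursion {Ω : Type*} [MeasurableSpace Ω] (μ : Measure Ω) (c K B : ℝ)
    (p F β : ℕ → ℝ) (s T A h g b : ℕ → Ω → ℝ) : Prop where
  binary : ∀ k ω, s k ω = 0 ∨ s k ω = 1
  meas : ∀ k, Measurable (s k)
  indep : iIndepFun s μ
  mean : ∀ k, ∫ ω, s k ω ∂μ = F k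
  F_mem : ∀ k, 0 ≤ F k ∧ F k ≤ 1
  dep_T : ∀ k, DependsOnFirst s k (T k)
  dep_A : ∀ k, DependsOnFirst s k (A k)
  dep_h : ∀ k, DependsOnFirst s k (h k)
  dep_g : ∀ k, DependsOnFirst s k (g k)
  dep_b : ∀ k, DependsOnFirst s k (b k)
  c_pos : 0 < c
  one_le_K : 1 ≤ K
  abs_p_le : ∀ k, |p k| ≤ B
  A_zero : ∀ ω, c ≤ A 0 ω ∧ A 0 ω ≤ K
  A_succ : ∀ k ω, A (k + 1) ω = A k ω + b k ω * p k ^ 2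
  T_succ : ∀ k ω, T (k + 1) ω =
    T k ω + (A (k + 1) ω)⁻¹ * p k * (h k ω - g k ω * (s k ω - F k))
  drift : ∀ k ω, h k ω * (p k * T k ω) ≤ -c * (p k * T k ω) ^ 2
  abs_h_le : ∀ k ω, |h k ω| ≤ K * |p k * T k ω|
  abs_g_le : ∀ k ω, |g k ω| ≤ K * (1 + |p k * T k ω|)
  remainder : ∀ k ω, |b k ω * (p k * T k ω) + h k ω| ≤ K * (p k * T k ω) ^ 2
  noise : ∀ k ω, |g k ω ^ 2 * (F k * (1 - F k)) - β k| ≤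
    K * (|p k * T k ω| + (p k * T k ω) ^ 2)
  weight : ∀ k ω, |b k ω - β k| ≤ K * |p k * T k ω|
  b_mem : ∀ k ω, c ≤ b k ω ∧ b k ω ≤ K
  β_mem : ∀ k, c ≤ β k ∧ β k ≤ K

namespace ErrorRecursion

variable {Ω : Type*} [MeasurableSpace Ω] {μ : Measure Ω} {c K B : ℝ}
  {p F β : ℕ → ℝ} {s T A h g b : ℕ → Ω → ℝ}

lemma state_eq (R : ErrorRecursion μ c K B p F β s T A h g b) {k : ℕ} {ω ω' : Ω}
    (H : ∀ i < k, s i ω = s i ω') :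
    T k ω = T k ω' ∧ A k ω = A k ω' ∧ h k ω = h k ω' ∧ g k ω = g k ω' ∧ b k ω = b k ω' :=
  ⟨R.dep_T k ω ω' H, R.dep_A k ω ω' H, R.dep_h k ω ω' H, R.dep_g k ω ω' H, R.dep_b k ω ω' H⟩

lemma dep_T_pow (R : ErrorRecursion μ c K B p F β s T A h g b) (k n : ℕ) :
    DependsOnFirst s k fun ω => T k ω ^ n := fun ω ω' H => by
  simp only [(R.state_eq H).1]

lemma dep_mul_pow (R : ErrorRecursion μ c K B p F β s T A h g b) (k n : ℕ) :
    DependsOnFirst s k fun ω => (A k ω * T k ω) ^ n := fun ω ω' H => by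
  simp only [(R.state_eq H).1, (R.state_eq H).2.1]

lemma integrable (R : ErrorRecursion μ c K B p F β s T A h g b) [IsProbabilityMeasure μ] {k : ℕ}
    {X : Ω → ℝ} (hX : DependsOnFirst s k X) : Integrable X μ :=
  hX.integrable R.binary R.meas

/-- Taking means in a one-step inequality removes the term linear in the observation error. -/
lemma integral_le_of_step (R : ErrorRecursion μ c K B p F β s T A h g b) [IsProbabilityMeasure μ]
    {k : ℕ} {Y Z X : Ω → ℝ} (hY : DependsOnFirst s (k + 1) Y) (hZ : DependsOnFirst s k Z)
    (hX : DependsOnFirst s k X) (hle : ∀ ω, Y ω ≤ Z ω + X ω * (s k ω - F k)) :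
    ∫ ω, Y ω ∂μ ≤ ∫ ω, Z ω ∂μ := by
  have hXv : DependsOnFirst s (k + 1) fun ω => X ω * (s k ω - F k) := fun ω ω' H => by
    simp only [hX.mono k.le_succ ω ω' H, H k k.lt_succ_self]
  calc ∫ ω, Y ω ∂μ ≤ ∫ ω, (Z ω + X ω * (s k ω - F k)) ∂μ :=
        integral_mono (R.integrable hY) ((R.integrable hZ).add (R.integrable hXv)) hle
    _ = ∫ ω, Z ω ∂μ := by
        rw [integral_add (R.integrable hZ) (R.integrable hXv),
          hX.integral_mul_sub_eq_zero R.binary R.meas R.indep (R.mean k), add_zero]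

lemma abs_sub_F_le (R : ErrorRecursion μ c K B p F β s T A h g b) (k : ℕ) (ω : Ω) :
    |s k ω - F k| ≤ 1 := by
  obtain ⟨h0, h1⟩ := R.F_mem k
  rw [abs_le]
  rcases R.binary k ω with e | e <;> rw [e] <;> constructor <;> linarith

lemma sub_F_sq (R : ErrorRecursion μ c K B p F β s T A h g b) (k : ℕ) (ω : Ω) :
    (s k ω - F k) ^ 2 = F k * (1 - F k) + (1 - 2 * F k) * (s k ω - F k) := by
  rcases R.binary k ω with e | e <;> rw [e] <;> ring

lemma A_mem (R : ErrorRecursion μ c K B p F β s T A h g b) (k : ℕ) (ω : Ω) :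
    c * gram p k ≤ A k ω ∧ A k ω ≤ K * gram p k := by
  induction k with
  | zero => simpa [gram] using R.A_zero ω
  | succ k ih =>
    obtain ⟨b1, b2⟩ := R.b_mem k ω
    have h1 := mul_le_mul_of_nonneg_right b1 (sq_nonneg (p k))
    have h2 := mul_le_mul_of_nonneg_right b2 (sq_nonneg (p k))
    rw [R.A_succ, gram_succ]
    constructor <;> linarith [ih.1, ih.2]

lemma A_pos (R : ErrorRecursion μ c K B p F β s T A h g b) (k : ℕ) (ω : Ω) : 0 < A k ω :=
  (mul_pos R.c_pos (gram_pos p k)).trans_le (R.A_mem k ω).1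

/-- Multiplying by the updated inverse gain removes the gain from the innovation, while `A (k + 1) *
T k` creates the term `b * p ^ 2 * T` that cancels the drift to first order. -/
lemma normalised_succ (R : ErrorRecursion μ c K B p F β s T A h g b) (k : ℕ) (ω : Ω) :
    A (k + 1) ω * T (k + 1) ω = A k ω * T k ω +
      (p k * (b k ω * (p k * T k ω) + h k ω) - p k * g k ω * (s k ω - F k)) := by
  have := (R.A_pos (k + 1) ω).ne'
  rw [R.T_succ, mul_add, ← mul_assoc, ← mul_assoc, mul_inv_cancel₀ this, R.A_succ]
  ring

lemma B_nonneg (R : ErrorRecursion μ c K B p F β s T A h g b) : 0 ≤ B :=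
  (abs_nonneg _).trans (R.abs_p_le 0)

lemma sq_p_le (R : ErrorRecursion μ c K B p F β s T A h g b) (k : ℕ) : p k ^ 2 ≤ B ^ 2 :=
  sq_le_sq' (by linarith [neg_abs_le (p k), R.abs_p_le k])
    ((le_abs_self _).trans (R.abs_p_le k))

/-- Some high even moment of the estimation error is bounded by the inverse square of the
cumulated squared inputs. -/
lemma exists_high_moment_le (R : ErrorRecursion μ c K B p F β s T A h g b)
    [IsProbabilityMeasure μ] (hD : Tendsto (gram p) atTop atTop) :
    ∃ j : ℕ, 3 ≤ j ∧ ∃ L, 0 ≤ L ∧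
      ∀ k, ∫ ω, T k ω ^ (2 * j + 2) ∂μ ≤ L / gram p k ^ 2 := by
  obtain ⟨j, C, D₀, hj, hC, hD₀, H⟩ := exists_high_power_step R.c_pos R.one_le_K B
  refine ⟨j, hj, ?_⟩
  -- Beyond `k₀` the one-step estimate applies, and `5 * B ^ 2 ≤ gram` keeps the factor `1 - 5 * x`
  -- nonnegative.
  obtain ⟨k₀, hk₀⟩ := eventually_atTop.1 (hD.eventually_ge_atTop (max D₀ (5 * B ^ 2)))
  have hbig : ∀ k ≥ k₀, max D₀ (5 * B ^ 2) ≤ gram p (k + 1) := fun k hk => hk₀ _ (by omega)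
  refine exists_le_div_gram_sq hC (fun k hk => ?_) (fun k hk => ?_) (k₀ := k₀)
  · rw [← mul_div_assoc, div_le_one (gram_pos p (k + 1))]
    exact le_trans (by linarith [R.sq_p_le k]) ((le_max_right _ _).trans (hbig k hk))
  · have hstep := R.integral_le_of_step (R.dep_T_pow (k + 1) (2 * j + 2))
      (Z := fun ω => (1 - 5 * (p k ^ 2 / gram p (k + 1))) * T k ω ^ (2 * j + 2) +
        C * (p k ^ 2 / gram p (k + 1)) / gram p (k + 1) ^ 2)
      (X := fun ω => -((2 * j + 2) * T k ω ^ (2 * j + 1) *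
        ((A k ω + b k ω * p k ^ 2)⁻¹ * p k * g k ω)))
      (fun ω ω' H => by simp only [(R.state_eq H).1])
      (fun ω ω' H => by
        obtain ⟨e1, e2, e3, e4, e5⟩ := R.state_eq H
        simp only [e1, e2, e4, e5])
      (fun ω => by
        have hA := R.A_mem (k + 1) ω
        have := H (T k ω) (p k) (h k ω) (g k ω) (s k ω - F k) (A (k + 1) ω) (gram p (k + 1))
          ((le_max_left _ _).trans (hbig k hk)) (R.abs_p_le k)
          (by rw [gram_succ]; linarith [gram_pos p k]) hA.1 hA.2 (R.abs_sub_F_le k ω)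
          (R.drift k ω) (R.abs_h_le k ω) (R.abs_g_le k ω)
        rw [← R.T_succ] at this
        rw [← R.A_succ]
        linarith)
    have hi := R.integrable (R.dep_T_pow k (2 * j + 2))
    rwa [integral_add (hi.const_mul _) (integrable_const _), integral_const_mul,
      integral_const, probReal_univ, one_smul] at hstep

lemma gram_le (R : ErrorRecursion μ c K B p F β s T A h g b) (k : ℕ) :
    gram p (k + 1) ≤ (1 + B ^ 2) * gram p k := by
  have := mul_le_mul_of_nonneg_left (one_le_gram p k) (sq_nonneg B)
  rw [gram_succ]; linarith [R.sq_p_le k]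

/-- The fourth power step applied to `A * T`, with the high moment controlling its last term;
division by `A ^ 4`, of order `gram ^ 4`, then returns to `T`. -/
lemma exists_fourth_moment_le (R : ErrorRecursion μ c K B p F β s T A h g b)
    [IsProbabilityMeasure μ] (hD : Tendsto (gram p) atTop atTop) :
    ∃ L, 0 ≤ L ∧ ∀ k, ∫ ω, T k ω ^ 4 ∂μ ≤ L / gram p k ^ 2 := by
  obtain ⟨j, hj, L, hL, hm⟩ := R.exists_high_moment_le hD
  obtain ⟨C, hC, H⟩ := exists_fourth_power_step R.c_pos R.one_le_K B
    (by omega : 8 ≤ 2 * j + 2) (by exact ⟨j + 1, by ring⟩)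
  obtain ⟨N, hN, hη⟩ := exists_le_mul_gram_sq (p := p)
    (N := fun k => ∫ ω, (A k ω * T k ω) ^ 4 ∂μ) (C := C + C * L * (1 + B ^ 2) ^ 2) (by positivity)
    (fun k => by
      have hstep := R.integral_le_of_step (R.dep_mul_pow (k + 1) 4)
        (Z := fun ω => (1 + p k ^ 2 / gram p (k + 1)) * (A k ω * T k ω) ^ 4 +
          C * p k ^ 2 * gram p (k + 1) + C * p k ^ 2 * gram p (k + 1) ^ 3 * T k ω ^ (2 * j + 2))
        (X := fun ω => -(4 * (A k ω * T k ω) ^ 3 * p k * g k ω))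
        (fun ω ω' H => by
          obtain ⟨e1, e2, e3, e4, e5⟩ := R.state_eq H
          simp only [e1, e2])
        (fun ω ω' H => by
          obtain ⟨e1, e2, e3, e4, e5⟩ := R.state_eq H
          simp only [e1, e2, e4])
        (fun ω => by
          have hA := R.A_mem k ω
          have := H (T k ω) (p k) (h k ω) (g k ω) (s k ω - F k) (b k ω) (A k ω) (gram p k)
            (gram p (k + 1)) (one_le_gram p k) (gram_succ p k) (R.abs_p_le k) hA.1 hA.2
            (R.abs_sub_F_le k ω) (R.abs_g_le k ω) (R.remainder k ω)
          rw [R.normalised_succ]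
          linarith)
      have i1 := R.integrable (R.dep_mul_pow k 4)
      have i2 := R.integrable (R.dep_T_pow k (2 * j + 2))
      have i3 : Integrable (fun ω => (1 + p k ^ 2 / gram p (k + 1)) * (A k ω * T k ω) ^ 4 +
          C * p k ^ 2 * gram p (k + 1)) μ := (i1.const_mul _).add (integrable_const _)
      rw [integral_add i3 (i2.const_mul _), integral_add (i1.const_mul _) (integrable_const _), integral_const,
        integral_const_mul, integral_const_mul, probReal_univ, one_smul] at hstep
      refine hstep.trans ?_
      have hg := R.gram_le k
      have h0 := gram_pos p k
      have h1 := gram_pos p (k + 1)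
      -- The high moment decays like `gram ^ (-2)`, so the term from large errors is only linear in
      -- `gram`, like the noise term.
      have e1 : gram p (k + 1) ^ 3 * ∫ ω, T k ω ^ (2 * j + 2) ∂μ ≤
          L * (1 + B ^ 2) ^ 2 * gram p (k + 1) := by
        calc gram p (k + 1) ^ 3 * ∫ ω, T k ω ^ (2 * j + 2) ∂μ
            ≤ gram p (k + 1) ^ 3 * (L / gram p k ^ 2) := by gcongr; exact hm k
          _ = L * (gram p (k + 1) / gram p k) ^ 2 * gram p (k + 1) := by field_simp
          _ ≤ _ := by
              gcongr
              rwa [div_le_iff₀ h0]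
      have e2 : 0 ≤ C * p k ^ 2 := by positivity
      linarith [mul_le_mul_of_nonneg_left e1 e2])
  have hc4 : 0 < c ^ 4 := pow_pos R.c_pos 4
  refine ⟨N / c ^ 4, by positivity, fun k => ?_⟩
  have h0 := gram_pos p k
  have i1 := R.integrable (R.dep_mul_pow k 4)
  have i2 := R.integrable (R.dep_T_pow k 4)
  have hle : ∫ ω, (c * gram p k) ^ 4 * T k ω ^ 4 ∂μ ≤ ∫ ω, (A k ω * T k ω) ^ 4 ∂μ :=
    integral_mono (i2.const_mul _) i1 fun ω => by
      have hcg : 0 ≤ c * gram p k := (mul_pos R.c_pos h0).le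
      simp only [mul_pow (A k ω)]
      have : 0 ≤ T k ω ^ 4 := by positivity
      gcongr
      exact (R.A_mem k ω).1
  rw [integral_const_mul] at hle
  rw [div_div, le_div_iff₀ (by positivity)]
  have := hle.trans (hη k)
  have h2 : 0 < gram p k ^ 2 := by positivity
  refine le_of_mul_le_mul_right ?_ h2
  calc _ = (c * gram p k) ^ 4 * ∫ ω, T k ω ^ 4 ∂μ := by ring
    _ ≤ _ := this

lemma integral_one_add_le (R : ErrorRecursion μ c K B p F β s T A h g b)
    [IsProbabilityMeasure μ] {L : ℝ} (hL : ∀ k, ∫ ω, T k ω ^ 4 ∂μ ≤ L / gram p k ^ 2)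
    (hL0 : 0 ≤ L) (k : ℕ) :
    ∫ ω, (1 + gram p (k + 1) ^ 2 * T k ω ^ 4) ∂μ ≤ 1 + L * (1 + B ^ 2) ^ 2 := by
  have i2 := R.integrable (R.dep_T_pow k 4)
  have h0 := gram_pos p k
  have h1 := gram_pos p (k + 1)
  rw [integral_add (integrable_const _) (i2.const_mul _), integral_const_mul, integral_const,
    probReal_univ, one_smul]
  refine add_le_add le_rfl ?_
  calc gram p (k + 1) ^ 2 * ∫ ω, T k ω ^ 4 ∂μ ≤ gram p (k + 1) ^ 2 * (L / gram p k ^ 2) := by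
        gcongr; exact hL k
    _ = L * (gram p (k + 1) / gram p k) ^ 2 := by field_simp
    _ ≤ _ := by
        gcongr
        rw [div_le_iff₀ h0]; exact R.gram_le k

/-- The second moment of the normalised error is the Fisher information up to lower order. -/
lemma exists_second_moment_sub_le (R : ErrorRecursion μ c K B p F β s T A h g b)
    [IsProbabilityMeasure μ] (hD : Tendsto (gram p) atTop atTop) :
    ∃ L, 0 ≤ L ∧ ∀ k, |∫ ω, (A k ω * T k ω) ^ 2 ∂μ - ∑ i ∈ Finset.range k, p i ^ 2 * β i| ≤
      L * √(gram p k) := by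
  obtain ⟨L, hL0, hL⟩ := R.exists_fourth_moment_le hD
  obtain ⟨C, hC, H⟩ := exists_square_step R.c_pos R.one_le_K R.B_nonneg
  set C' := C * (1 + L * (1 + B ^ 2) ^ 2) with hC'
  have hC'0 : 0 ≤ C' := by positivity
  have key := abs_sub_sum_le_mul_sqrt_gram (p := p)
    (a := fun k => ∫ ω, (A k ω * T k ω) ^ 2 ∂μ) (i := fun i => p i ^ 2 * β i) (C := C') hC'0
    (fun k => by
      have hx0 : 0 ≤ p k ^ 2 / √(gram p (k + 1)) := by positivity
      have i1 := R.integrable (R.dep_mul_pow k 2)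
      have i2 : Integrable (fun ω => 1 + gram p (k + 1) ^ 2 * T k ω ^ 4) μ :=
        R.integrable (k := k) fun ω ω' H => by simp only [(R.state_eq H).1]
      have hI := R.integral_one_add_le hL hL0 k
      have hpt : ∀ ω, ∃ Q, _ ∧ _ := fun ω =>
        H (T k ω) (p k) (h k ω) (g k ω) (s k ω - F k) (b k ω) (A k ω) (gram p k)
            (gram p (k + 1)) (F k * (1 - F k)) (1 - 2 * F k) (β k) (one_le_gram p k)
            (gram_succ p k) (R.abs_p_le k) (R.A_mem k ω).1 (R.A_mem k ω).2
            (R.abs_sub_F_le k ω) (R.abs_g_le k ω) (R.remainder k ω) (R.sub_F_sq k ω)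
            (R.noise k ω)
      have hup := R.integral_le_of_step (R.dep_mul_pow (k + 1) 2)
        (Z := fun ω => (A k ω * T k ω) ^ 2 + p k ^ 2 * β k + C * (p k ^ 2 / √(gram p (k + 1))) *
          (1 + gram p (k + 1) ^ 2 * T k ω ^ 4))
        (X := fun ω => p k ^ 2 * g k ω ^ 2 * (1 - 2 * F k) -
          2 * (A k ω * T k ω + p k * (b k ω * (p k * T k ω) + h k ω)) * p k * g k ω)
        (fun ω ω' H => by
          obtain ⟨e1, e2, e3, e4, e5⟩ := R.state_eq H
          simp only [e1, e2])
        (fun ω ω' H => by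
          obtain ⟨e1, e2, e3, e4, e5⟩ := R.state_eq H
          simp only [e1, e2, e3, e4, e5])
        (fun ω => by
          obtain ⟨Q, hQ, hQ2⟩ := hpt ω
          rw [R.normalised_succ, hQ]
          linarith [le_abs_self Q])
      -- `integral_le_of_step` is one-sided; the lower bound comes from applying it to the negated
      -- square.
      have hlo := R.integral_le_of_step (k := k) (Y := fun ω => -(A (k + 1) ω * T (k + 1) ω) ^ 2)
        (Z := fun ω => -((A k ω * T k ω) ^ 2 + p k ^ 2 * β k) +
          C * (p k ^ 2 / √(gram p (k + 1))) * (1 + gram p (k + 1) ^ 2 * T k ω ^ 4))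
        (X := fun ω => -(p k ^ 2 * g k ω ^ 2 * (1 - 2 * F k) -
          2 * (A k ω * T k ω + p k * (b k ω * (p k * T k ω) + h k ω)) * p k * g k ω))
        (fun ω ω' H => by
          obtain ⟨e1, e2, e3, e4, e5⟩ := R.state_eq H
          simp only [e1, e2])
        (fun ω ω' H => by
          obtain ⟨e1, e2, e3, e4, e5⟩ := R.state_eq H
          simp only [e1, e2])
        (fun ω ω' H => by
          obtain ⟨e1, e2, e3, e4, e5⟩ := R.state_eq H
          simp only [e1, e2, e3, e4, e5])
        (fun ω => by
          obtain ⟨Q, hQ, hQ2⟩ := hpt ω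
          rw [R.normalised_succ, hQ]
          linarith [neg_abs_le Q])
      have i3 : Integrable (fun ω => (A k ω * T k ω) ^ 2 + p k ^ 2 * β k) μ :=
        i1.add (integrable_const _)
      have i4 : Integrable (fun ω => -((A k ω * T k ω) ^ 2 + p k ^ 2 * β k)) μ := i3.neg
      rw [integral_add i3 (i2.const_mul _), integral_add i1 (integrable_const _),
        integral_const, integral_const_mul, probReal_univ, one_smul] at hup
      rw [integral_neg, integral_add i4 (i2.const_mul _), integral_neg,
        integral_add i1 (integrable_const _),
        integral_const, integral_const_mul, probReal_univ, one_smul] at hlo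
      have hb : C * (p k ^ 2 / √(gram p (k + 1))) *
          ∫ ω, (1 + gram p (k + 1) ^ 2 * T k ω ^ 4) ∂μ ≤ C' * (p k ^ 2 / √(gram p (k + 1))) := by
        calc _ ≤ C * (p k ^ 2 / √(gram p (k + 1))) * (1 + L * (1 + B ^ 2) ^ 2) := by gcongr
          _ = _ := by rw [hC']; ring
      simp only [abs_le]
      constructor <;> linarith)
  set a₀ := ∫ ω, (A 0 ω * T 0 ω) ^ 2 ∂μ with ha₀
  refine ⟨2 * C' + |a₀|, by positivity, fun k => ?_⟩
  have hs : 1 ≤ √(gram p k) := Real.one_le_sqrt.2 (one_le_gram p k)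
  have h1 := abs_le.1 (key k)
  have h2 := abs_le.1 (le_refl |a₀|)
  have h3 : |a₀| ≤ |a₀| * √(gram p k) := le_mul_of_one_le_right (abs_nonneg _) hs
  rw [abs_le]
  constructor <;> linarith [h1.1, h1.2, h2.1, h2.2]

lemma fisher_mem (R : ErrorRecursion μ c K B p F β s T A h g b) (k : ℕ) :
    c * (gram p k - 1) ≤ ∑ i ∈ Finset.range k, p i ^ 2 * β i ∧
      ∑ i ∈ Finset.range k, p i ^ 2 * β i ≤ K * (gram p k - 1) := by
  simp only [gram, add_sub_cancel_left, Finset.mul_sum]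
  constructor <;> refine Finset.sum_le_sum fun i _ => ?_
  · rw [mul_comm c]; gcongr; exact (R.β_mem i).1
  · rw [mul_comm K]; gcongr; exact (R.β_mem i).2

/-- Mean square distance between the inverse gain and the Fisher information. -/
lemma exists_information_sub_sq_le (R : ErrorRecursion μ c K B p F β s T A h g b)
    [IsProbabilityMeasure μ] (hD : Tendsto (gram p) atTop atTop) :
    ∃ L, 0 ≤ L ∧ ∀ k, ∫ ω, (A k ω - ∑ i ∈ Finset.range k, p i ^ 2 * β i) ^ 2 ∂μ ≤
      L * (gram p k * √(gram p k)) := by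
  obtain ⟨L, hL0, hL⟩ := R.exists_fourth_moment_le hD
  obtain ⟨C, hC, H⟩ := exists_information_step R.one_le_K R.B_nonneg
  set C' := C * (1 + L * (1 + B ^ 2) ^ 2) with hC'
  have hC'0 : 0 ≤ C' := by positivity
  have hK0 : 0 < K := by linarith [R.one_le_K]
  have hdep : ∀ k, DependsOnFirst s k
      fun ω => (A k ω - ∑ i ∈ Finset.range k, p i ^ 2 * β i) ^ 2 := fun k ω ω' H => by
    simp only [(R.state_eq H).2.1]
  have key := le_add_mul_gram_mul_sqrt (p := p)
    (a := fun k => ∫ ω, (A k ω - ∑ i ∈ Finset.range k, p i ^ 2 * β i) ^ 2 ∂μ) hC'0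
    (fun k => by
      have hI := R.integral_one_add_le hL hL0 k
      have i1 := R.integrable (hdep k)
      have i2 : Integrable (fun ω => 1 + gram p (k + 1) ^ 2 * T k ω ^ 4) μ :=
        R.integrable (k := k) fun ω ω' H => by simp only [(R.state_eq H).1]
      have hle := integral_mono (μ := μ) (R.integrable (hdep (k + 1)))
        (i1.add (i2.const_mul (C * (p k ^ 2 * √(gram p (k + 1)))))) (fun ω => by
          have hf := R.fisher_mem k
          have hA := R.A_mem k ω
          have hg0 := gram_pos p k
          have hKg : 0 ≤ K * gram p k := by positivity
          have hcg : 0 ≤ c * (gram p k - 1) :=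
            mul_nonneg R.c_pos.le (by linarith [one_le_gram p k])
          have := H (T k ω) (p k) (b k ω) (β k) (A k ω - ∑ i ∈ Finset.range k, p i ^ 2 * β i)
            (gram p (k + 1)) (one_le_gram p _) (R.abs_p_le k) (R.weight k ω)
            (by
              have hmono : K * gram p k ≤ K * gram p (k + 1) := by
                gcongr; exact gram_mono p k.le_succ
              rw [abs_le]
              constructor <;> linarith [hf.1, hf.2, hA.1, hA.2, R.A_pos k ω])
          simp only [Pi.add_apply]
          refine le_trans (le_of_eq ?_) this
          rw [R.A_succ, Finset.sum_range_succ]; ring)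
      have hadd := integral_add i1 (i2.const_mul (C * (p k ^ 2 * √(gram p (k + 1)))))
      simp only [Pi.add_apply] at hle
      rw [hadd, integral_const_mul] at hle
      refine hle.trans (add_le_add le_rfl ?_)
      calc _ ≤ C * (p k ^ 2 * √(gram p (k + 1))) * (1 + L * (1 + B ^ 2) ^ 2) := by gcongr
          _ = _ := by rw [hC']; ring)
  set a₀ := ∫ ω, (A 0 ω - ∑ i ∈ Finset.range 0, p i ^ 2 * β i) ^ 2 ∂μ with ha₀
  refine ⟨|a₀| + C', by positivity, fun k => (key k).trans ?_⟩
  have hs : 1 ≤ gram p k * √(gram p k) :=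
    one_le_mul_of_one_le_of_one_le (one_le_gram p k) (Real.one_le_sqrt.2 (one_le_gram p k))
  have h3 : |a₀| ≤ |a₀| * (gram p k * √(gram p k)) := le_mul_of_one_le_right (abs_nonneg _) hs
  linarith [le_abs_self a₀]

/-- Replacing the inverse gain by the Fisher information changes the normalised mean square error
by a lower order term. -/
lemma exists_normalised_sub_le (R : ErrorRecursion μ c K B p F β s T A h g b)
    [IsProbabilityMeasure μ] (hD : Tendsto (gram p) atTop atTop) :
    ∃ L, 0 ≤ L ∧ ∀ k, |∫ ω, (A k ω * T k ω) ^ 2 ∂μ -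
      (∑ i ∈ Finset.range k, p i ^ 2 * β i) ^ 2 * ∫ ω, T k ω ^ 2 ∂μ| ≤
        L * (gram p k / √(√(gram p k))) := by
  obtain ⟨L, hL0, hL⟩ := R.exists_fourth_moment_le hD
  obtain ⟨L', hL'0, hL'⟩ := R.exists_information_sub_sq_le hD
  have hK0 : 0 < K := by linarith [R.one_le_K]
  refine ⟨2 * K * (L' + L), by positivity, fun k => ?_⟩
  have hg0 := gram_pos p k
  have hf := R.fisher_mem k
  have hL'k := hL' k
  set I := ∑ i ∈ Finset.range k, p i ^ 2 * β i
  obtain ⟨r, hr⟩ : ∃ r, r = √(√(gram p k)) := ⟨_, rfl⟩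
  have hr0 : 0 < r := by rw [hr]; positivity
  have hr2 : √(gram p k) = r ^ 2 := by rw [hr, Real.sq_sqrt (Real.sqrt_nonneg _)]
  have hr4 : gram p k = r ^ 4 := by
    rw [← Real.sq_sqrt hg0.le, hr2]; ring
  have hdep : DependsOnFirst s k fun ω => (A k ω - I) ^ 2 := fun ω ω' H => by
    simp only [(R.state_eq H).2.1]
  have i0 := R.integrable (R.dep_mul_pow k 2)
  have i1 := R.integrable hdep
  have i2 := R.integrable (R.dep_T_pow k 4)
  have i3 := R.integrable (R.dep_T_pow k 2)
  -- Young's inequality with weight `r ^ 7`, where `r = gram ^ (1/4)`: the mean of `(A - I) ^ 2` is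
  -- of order `r ^ 6` and that of `T ^ 4` of order `r ^ (-8)`, so both terms become `r ^ (-1)`.
  have hpt : ∀ ω, |(A k ω * T k ω) ^ 2 - I ^ 2 * T k ω ^ 2| ≤
      2 * K * gram p k * ((r ^ 7)⁻¹ * (A k ω - I) ^ 2 + r ^ 7 * T k ω ^ 4) := fun ω => by
    have hA := R.A_mem k ω
    have hI0 : 0 ≤ I := le_trans (mul_nonneg R.c_pos.le (by linarith [one_le_gram p k])) hf.1
    have hAI : |A k ω + I| ≤ 2 * K * gram p k := by
      rw [abs_of_nonneg (by linarith [R.A_pos k ω])]; linarith [hA.2, hf.2]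
    have hy : |A k ω - I| * T k ω ^ 2 ≤ (r ^ 7)⁻¹ * (A k ω - I) ^ 2 + r ^ 7 * T k ω ^ 4 := by
      have h7 : 0 < r ^ 7 := by positivity
      have e : (r ^ 7)⁻¹ * (A k ω - I) ^ 2 + r ^ 7 * T k ω ^ 4 - 2 * (|A k ω - I| * T k ω ^ 2) =
          (r ^ 7)⁻¹ * (|A k ω - I| - r ^ 7 * T k ω ^ 2) ^ 2 := by
        rw [← sq_abs (A k ω - I)]; field_simp; ring
      have e2 : 0 ≤ (r ^ 7)⁻¹ * (|A k ω - I| - r ^ 7 * T k ω ^ 2) ^ 2 := by positivity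
      have e3 : 0 ≤ |A k ω - I| * T k ω ^ 2 := by positivity
      linarith
    calc _ = |A k ω + I| * (|A k ω - I| * T k ω ^ 2) := by
          rw [show (A k ω * T k ω) ^ 2 - I ^ 2 * T k ω ^ 2 =
            (A k ω + I) * ((A k ω - I) * T k ω ^ 2) by ring, abs_mul, abs_mul,
            abs_of_nonneg (sq_nonneg (T k ω))]
      _ ≤ _ := by gcongr
  rw [← integral_const_mul, ← integral_sub i0 (i3.const_mul _)]
  have i4 : Integrable (fun ω => (r ^ 7)⁻¹ * (A k ω - I) ^ 2 + r ^ 7 * T k ω ^ 4) μ :=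
    (i1.const_mul _).add (i2.const_mul _)
  calc _ ≤ ∫ ω, |(A k ω * T k ω) ^ 2 - I ^ 2 * T k ω ^ 2| ∂μ := abs_integral_le_integral_abs
    _ ≤ ∫ ω, 2 * K * gram p k * ((r ^ 7)⁻¹ * (A k ω - I) ^ 2 + r ^ 7 * T k ω ^ 4) ∂μ :=
        integral_mono (i0.sub (i3.const_mul _)).abs (i4.const_mul _) hpt
    _ = 2 * K * gram p k * ((r ^ 7)⁻¹ * ∫ ω, (A k ω - I) ^ 2 ∂μ + r ^ 7 * ∫ ω, T k ω ^ 4 ∂μ) := by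
        rw [integral_const_mul, integral_add (i1.const_mul _) (i2.const_mul _),
          integral_const_mul, integral_const_mul]
    _ ≤ 2 * K * gram p k * ((r ^ 7)⁻¹ * (L' * (gram p k * √(gram p k))) +
          r ^ 7 * (L / gram p k ^ 2)) := by
        gcongr
        exact hL k
    _ = _ := by
        rw [← hr, hr2, hr4]; field_simp

/-- Asymptotic efficiency of the recursion. -/
theorem tendsto_efficiency (R : ErrorRecursion μ c K B p F β s T A h g b)
    [IsProbabilityMeasure μ] (hD : Tendsto (gram p) atTop atTop) :
    Tendsto (fun k => (∑ i ∈ Finset.range k, p i ^ 2 * β i) *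
      ((∫ ω, T k ω ^ 2 ∂μ) - (∑ i ∈ Finset.range k, p i ^ 2 * β i)⁻¹)) atTop (𝓝 0) := by
  obtain ⟨L₁, hL₁, h₁⟩ := R.exists_second_moment_sub_le hD
  obtain ⟨L₂, hL₂, h₂⟩ := R.exists_normalised_sub_le hD
  have hlim : Tendsto (fun k => 2 / c * (L₁ + L₂) / √(√(gram p k))) atTop (𝓝 0) :=
    tendsto_const_nhds.div_atTop
      (Real.tendsto_sqrt_atTop.comp (Real.tendsto_sqrt_atTop.comp hD))
  refine squeeze_zero_norm' ?_ hlim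
  -- Once `gram` is at least 2, removing its unit initial value at most halves it.
  filter_upwards [hD.eventually_ge_atTop 2] with k hk
  have hc := R.c_pos
  have e1 := h₁ k
  have e2 := h₂ k
  have hf := (R.fisher_mem k).1
  set I := ∑ i ∈ Finset.range k, p i ^ 2 * β i
  have hg0 := gram_pos p k
  obtain ⟨r, hr⟩ : ∃ r, r = √(√(gram p k)) := ⟨_, rfl⟩
  have hr1 : 1 ≤ r := by
    rw [hr]; exact Real.one_le_sqrt.2 (Real.one_le_sqrt.2 (one_le_gram p k))
  have hr2 : √(gram p k) = r ^ 2 := by rw [hr, Real.sq_sqrt (Real.sqrt_nonneg _)]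
  have hr4 : gram p k = r ^ 4 := by
    rw [← Real.sq_sqrt hg0.le, hr2]; ring
  have hI : c / 2 * gram p k ≤ I := by
    refine le_trans ?_ hf
    linarith [mul_le_mul_of_nonneg_left hk hc.le]
  rw [← hr] at e2 ⊢
  rw [hr2] at e1
  rw [hr4] at e2 hI
  have hI0 : 0 < I := lt_of_lt_of_le (by positivity) hI
  have hr0 : 0 < r := by linarith
  rw [Real.norm_eq_abs, mul_sub, mul_inv_cancel₀ hI0.ne']
  have e3 : |I * (I * ∫ ω, T k ω ^ 2 ∂μ - 1)| ≤ (L₁ + L₂) * r ^ 3 := by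
    have e4 : r ^ 4 / r = r ^ 3 := by field_simp
    have e5 : L₁ * r ^ 2 ≤ L₁ * r ^ 3 := by gcongr; norm_num
    rw [e4] at e2
    have a1 := abs_le.1 e1
    have a2 := abs_le.1 e2
    rw [abs_le]
    constructor <;> linarith [a1.1, a1.2, a2.1, a2.2]
  rw [abs_mul, abs_of_pos hI0] at e3
  rw [le_div_iff₀ hr0]
  have e6 : c / 2 * r ^ 4 * |I * ∫ ω, T k ω ^ 2 ∂μ - 1| ≤ (L₁ + L₂) * r ^ 3 :=
    (mul_le_mul_of_nonneg_right hI (abs_nonneg _)).trans e3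
  have hr3 : 0 < c / 2 * r ^ 3 := by positivity
  refine le_of_mul_le_mul_left ?_ hr3
  calc _ = c / 2 * r ^ 4 * |I * ∫ ω, T k ω ^ 2 ∂μ - 1| := by ring
    _ ≤ _ := e6
    _ = _ := by field_simp

end ErrorRecursion

/-! ### The algorithm as an instance of the error recursion. -/

lemma gainUpdate_eq_div {b φ P : ℝ} (hb : 0 < b) (hP : 0 < P) :
    gainUpdate b φ P = P / (1 + b * φ ^ 2 * P) := by
  have h : 1 + b * φ ^ 2 * P ≠ 0 := by positivity
  unfold gainUpdate
  rw [show 1 + b * φ * P * φ = 1 + b * φ ^ 2 * P by ring]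
  field_simp
  ring

lemma gainUpdate_pos {b φ P : ℝ} (hb : 0 < b) (hP : 0 < P) : 0 < gainUpdate b φ P := by
  rw [gainUpdate_eq_div hb hP]; positivity

lemma inv_gainUpdate {b φ P : ℝ} (hb : 0 < b) (hP : 0 < P) :
    (gainUpdate b φ P)⁻¹ = P⁻¹ + b * φ ^ 2 := by
  rw [gainUpdate_eq_div hb hP]
  field_simp

lemma impf_gain_pos (C : ℝ) {σ : ℝ} (hσ : 0 < σ) (M : ℝ) (φ s : ℕ → ℝ) (θ₀ : ℝ) {P₀ : ℝ}
    (hP₀ : 0 < P₀) (k : ℕ) : 0 < (impf C σ M φ s θ₀ P₀ k).2 := by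
  induction k with
  | zero => exact hP₀
  | succ k ih => exact gainUpdate_pos (betaCoef_pos C hσ _) ih

/-- The state at time `k` uses only the data numbered 1 to `k`; after the shift by one these are the
first `k` terms, as `DependsOnFirst` demands. -/
lemma impf_congr {C σ M : ℝ} {φ s s' : ℕ → ℝ} {θ₀ P₀ : ℝ} {k : ℕ}
    (h : ∀ i < k, s (i + 1) = s' (i + 1)) :
    impf C σ M φ s θ₀ P₀ k = impf C σ M φ s' θ₀ P₀ k := by
  induction k with
  | zero => rfl
  | succ k ih =>
    simp only [impf, ih fun i hi => h i (hi.trans k.lt_succ_self), h k k.lt_succ_self]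

lemma information_eq_sum_range (C σ θ : ℝ) (φ : ℕ → ℝ) (k : ℕ) :
    information C σ θ φ k =
      ∑ i ∈ Finset.range k, φ (i + 1) ^ 2 * betaCoef C σ (φ (i + 1) * θ) := by
  induction k with
  | zero => simp [information]
  | succ k ih =>
    rw [Finset.sum_range_succ, ← ih, information, information,
      Finset.sum_Icc_succ_top (by omega)]
    ring

lemma gram_add (φ : ℕ → ℝ) (m n : ℕ) :
    gram (fun k => φ (k + 1)) (m + n) =
      gram (fun k => φ (k + 1)) m + ∑ i ∈ Finset.Icc (m + 1) (m + n), φ i ^ 2 := by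
  induction n with
  | zero => simp
  | succ n ih =>
    rw [← add_assoc, gram_succ, ih, Finset.sum_Icc_succ_top (by omega)]
    ring

lemma le_gram_add {φ : ℕ → ℝ} {N : ℕ} (hN : 1 ≤ N) {δ : ℝ}
    (hφ : ∀ k ≥ 1, δ ^ 2 ≤ (1 / (N : ℝ)) * ∑ i ∈ Finset.Icc k (k + N - 1), φ i ^ 2) (m : ℕ) :
    gram (fun k => φ (k + 1)) m + N * δ ^ 2 ≤ gram (fun k => φ (k + 1)) (m + N) := by
  have h := hφ (m + 1) (by omega)
  have hN0 : (0 : ℝ) < N := by exact_mod_cast hN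
  rw [show m + 1 + N - 1 = m + N by omega, one_div, le_inv_mul_iff₀ hN0] at h
  rw [gram_add]; linarith

lemma tendsto_gram_of_excitation {φ : ℕ → ℝ} {N : ℕ} (hN : 1 ≤ N) {δ : ℝ} (hδ : 0 < δ)
    (hφ : ∀ k ≥ 1, δ ^ 2 ≤ (1 / (N : ℝ)) * ∑ i ∈ Finset.Icc k (k + N - 1), φ i ^ 2) :
    Tendsto (gram fun k => φ (k + 1)) atTop atTop := by
  have hN0 : (0 : ℝ) < N := by exact_mod_cast hN
  have hstep : 0 < N * δ ^ 2 := by positivity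
  have hlow : ∀ j : ℕ, j * (N * δ ^ 2) ≤ gram (fun k => φ (k + 1)) (j * N) := fun j => by
    induction j with
    | zero => simpa using (gram_pos _ 0).le
    | succ j ih =>
      have := le_gram_add hN hφ (j * N)
      rw [show (j + 1) * N = j * N + N by ring]
      push_cast; linarith
  refine tendsto_atTop_atTop_of_monotone (gram_mono _) fun x => ?_
  obtain ⟨j, hj⟩ := exists_nat_ge (x / (N * δ ^ 2))
  rw [div_le_iff₀ hstep] at hj
  exact ⟨j * N, hj.trans (hlow j)⟩

lemma integral_observation {Ω : Type*} [MeasurableSpace Ω] {μ : Measure Ω} {d : Ω → ℝ}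
    (hd : Measurable d) {σ : ℝ} (hlaw : μ.map d = gaussianReal 0 (Real.toNNReal (σ ^ 2)))
    (C θ φ : ℝ) :
    ∫ ω, observation C (output θ φ (d ω)) ∂μ = noiseCDF σ (C - φ * θ) := by
  have h : (fun ω => observation C (output θ φ (d ω))) =
      (d ⁻¹' Set.Iic (C - φ * θ)).indicator 1 := by
    funext ω
    by_cases hω : d ω ≤ C - φ * θ
    · rw [Set.indicator_of_mem (show ω ∈ d ⁻¹' Set.Iic (C - φ * θ) from hω), Pi.one_apply]
      exact if_pos (le_sub_iff_add_le'.1 hω)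
    · rw [Set.indicator_of_notMem (show ω ∉ d ⁻¹' Set.Iic (C - φ * θ) from hω)]
      exact if_neg fun h => hω (le_sub_iff_add_le'.2 h)
  rw [h, integral_indicator_one (hd measurableSet_Iic), noiseCDF, cdf_eq_real, ← hlaw,
    map_measureReal_apply hd measurableSet_Iic]

lemma measurable_observation (C θ φ : ℝ) : Measurable fun x => observation C (output θ φ x) := by
  unfold observation output
  exact Measurable.ite (measurableSet_le (by fun_prop) (by fun_prop)) measurable_const
    measurable_const

/-- The estimation error of the algorithm satisfies the recursion studied in `ErrorRecursion`. -/
lemma exists_errorRecursion {Ω : Type*} [MeasurableSpace Ω] (μ : Measure Ω)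
    (C θ θbar : ℝ) (hθ : |θ| ≤ θbar) (σ : ℝ) (hσ : 0 < σ) (d : ℕ → Ω → ℝ)
    (hd_meas : ∀ k ≥ 1, Measurable (d k)) (hd_indep : iIndepFun (fun k : ℕ => d (k + 1)) μ)
    (hd_law : ∀ k ≥ 1, μ.map (d k) = gaussianReal 0 (Real.toNNReal (σ ^ 2)))
    (φ : ℕ → ℝ) (φbar : ℝ) (hφ : ∀ k, |φ (k + 1)| ≤ φbar) (θ₀ P₀ : ℝ) (hP₀ : 0 < P₀) :
    ∃ (c K : ℝ) (A h g b : ℕ → Ω → ℝ), ErrorRecursion μ c K φbar (fun k => φ (k + 1))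
      (fun k => noiseCDF σ (C - φ (k + 1) * θ)) (fun k => betaCoef C σ (φ (k + 1) * θ))
      (fun k ω => observation C (output θ (φ (k + 1)) (d (k + 1) ω)))
      (fun k ω => estimate C σ (φbar * θbar + 2) θ φ d θ₀ P₀ k ω - θ) A h g b := by
  set M := φbar * θbar + 2 with hM
  have hφbar : 0 ≤ φbar := (abs_nonneg _).trans (hφ 0)
  have hθbar : 0 ≤ θbar := (abs_nonneg _).trans hθ
  have hM2 : 2 ≤ M := by linarith [mul_nonneg hφbar hθbar]
  obtain ⟨c, K, hc, hK, H⟩ := exists_score_bounds C hσ hM2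
  have hy : ∀ k, |φ (k + 1) * θ| ≤ M - 2 := fun k => by
    rw [abs_mul, hM, add_sub_cancel_right]
    exact mul_le_mul (hφ k) hθ (abs_nonneg _) hφbar
  set s : Ω → ℕ → ℝ := fun ω i => observation C (output θ (φ i) (d i ω))
  set x : ℕ → Ω → ℝ := fun k ω => φ (k + 1) * (impf C σ M φ (s ω) θ₀ P₀ k).1
  have hdep : ∀ k ω ω', (∀ i < k, s ω (i + 1) = s ω' (i + 1)) →
      impf C σ M φ (s ω) θ₀ P₀ k = impf C σ M φ (s ω') θ₀ P₀ k := fun k ω ω' h => impf_congr h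
  have hPpos : ∀ k ω, 0 < (impf C σ M φ (s ω) θ₀ P₀ k).2 := fun k ω =>
    impf_gain_pos C hσ M φ (s ω) θ₀ hP₀ k
  have hx : ∀ k ω, φ (k + 1) * (estimate C σ M θ φ d θ₀ P₀ k ω - θ) =
      x k ω - φ (k + 1) * θ := fun k ω => mul_sub _ _ _
  have hcc : min c P₀⁻¹ ≤ c := min_le_left _ _
  have hKK : K ≤ max K P₀⁻¹ := le_max_left _ _
  -- Widening the constants by `P₀⁻¹` places the initial inverse gain between them; all other bounds
  -- survive the weakening.
  refine ⟨min c P₀⁻¹, max K P₀⁻¹, fun k ω => (impf C σ M φ (s ω) θ₀ P₀ k).2⁻¹,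
    fun k ω => meanScore C σ M (x k ω) (φ (k + 1) * θ), fun k ω => scoreCoef C σ M (x k ω),
    fun k ω => betaCoef C σ (cutoff M (x k ω)), ?_⟩
  constructor
  case binary =>
    intro k ω
    unfold observation
    split_ifs <;> simp
  case meas => exact fun k => (measurable_observation C θ _).comp (hd_meas (k + 1) (by omega))
  case indep => exact hd_indep.comp _ fun k => measurable_observation C θ (φ (k + 1))
  case mean =>
    exact fun k => integral_observation (hd_meas (k + 1) (by omega)) (hd_law (k + 1) (by omega)) _ _ _
  case F_mem => exact fun k => ⟨(noiseCDF_pos hσ _).le, (noiseCDF_lt_one hσ _).le⟩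
  case dep_T =>
    intro k ω ω' h
    have := hdep k ω ω' h
    simp only [estimate, s] at this ⊢
    rw [this]
  case dep_A =>
    intro k ω ω' h
    simp only [hdep k ω ω' h]
  case dep_h =>
    intro k ω ω' h
    simp only [x, hdep k ω ω' h]
  case dep_g =>
    intro k ω ω' h
    simp only [x, hdep k ω ω' h]
  case dep_b =>
    intro k ω ω' h
    simp only [x, hdep k ω ω' h]
  case c_pos => positivity
  case one_le_K => exact hK.trans hKK
  case abs_p_le => exact hφ
  case A_zero => exact fun ω => ⟨min_le_right _ _, le_max_right _ _⟩
  case A_succ => exact fun k ω => inv_gainUpdate (betaCoef_pos C hσ _) (hPpos k ω)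
  case T_succ =>
    intro k ω
    simp only [inv_inv, estimate, impf, meanScore, scoreCoef, x, s]
    ring
  case drift =>
    intro k ω
    simp only [hx]
    refine (H (x k ω) _ (hy k)).1.trans ?_
    exact mul_le_mul_of_nonneg_right (by linarith) (sq_nonneg _)
  case abs_h_le =>
    intro k ω
    simp only [hx]
    exact (H (x k ω) _ (hy k)).2.1.trans (by gcongr)
  case abs_g_le =>
    intro k ω
    simp only [hx]
    exact (H (x k ω) _ (hy k)).2.2.1.trans (by gcongr)
  case remainder =>
    intro k ω
    simp only [hx]
    exact (H (x k ω) _ (hy k)).2.2.2.1.trans (by gcongr)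
  case noise =>
    intro k ω
    simp only [hx]
    exact (H (x k ω) _ (hy k)).2.2.2.2.1.trans (by gcongr)
  case weight =>
    intro k ω
    simp only [hx]
    exact (H (x k ω) _ (hy k)).2.2.2.2.2.1.trans (by gcongr)
  case b_mem =>
    intro k ω
    have := (H (x k ω) _ (hy k)).2.2.2.2.2.2.1
    exact ⟨hcc.trans this.1, this.2.trans hKK⟩
  case β_mem =>
    intro k
    -- The bound on the true weight does not involve the prediction, so the value 0 is an arbitrary
    -- choice.
    have := (H 0 _ (hy k)).2.2.2.2.2.2.2
    exact ⟨hcc.trans this.1, this.2.trans hKK⟩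

end BinaryFIR

end

theorem theorem4 {Ω : Type*} [MeasurableSpace Ω] (μ : Measure Ω) [IsProbabilityMeasure μ]
    (C θ θbar : ℝ) (hθ : |θ| ≤ θbar)
    (σ : ℝ) (hσ : 0 < σ) (d : ℕ → Ω → ℝ)
    (hd_meas : ∀ k ≥ 1, Measurable (d k))
    (hd_indep : iIndepFun (fun k : ℕ => d (k + 1)) μ)
    (hd_law : ∀ k ≥ 1, μ.map (d k) = gaussianReal 0 (Real.toNNReal (σ ^ 2)))
    (φ : ℕ → ℝ) (φbar : ℝ) (hφ_sup : IsLUB ((fun k => |φ k|) '' Set.Ici 1) φbar)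
    (N : ℕ) (hN : 1 ≤ N) (δ : ℝ) (hδ : 0 < δ)
    (hφ_exc : ∀ k ≥ 1, δ ^ 2 ≤ (1 / (N : ℝ)) * ∑ i ∈ Finset.Icc k (k + N - 1), φ i ^ 2)
    (θ₀ P₀ : ℝ) (hP₀ : 0 < P₀) :
    (∀ k, Integrable
      (fun ω => (BinaryFIR.estimate C σ (φbar * θbar + 2) θ φ d θ₀ P₀ k ω - θ) ^ 2) μ) ∧
    (∀ k ≥ N, 0 < BinaryFIR.information C σ θ φ k) ∧
    Tendsto
      (fun k => (BinaryFIR.crBound C σ θ φ k)⁻¹ *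
        ((∫ ω, (BinaryFIR.estimate C σ (φbar * θbar + 2) θ φ d θ₀ P₀ k ω - θ) ^ 2 ∂μ)
          - BinaryFIR.crBound C σ θ φ k))
      atTop (𝓝 0) := by
  have hφ : ∀ k, |φ (k + 1)| ≤ φbar := fun k =>
    hφ_sup.1 ⟨k + 1, Set.mem_Ici.2 (by omega), rfl⟩
  obtain ⟨c, K, A, h, g, b, R⟩ := BinaryFIR.exists_errorRecursion μ C θ θbar hθ σ hσ d hd_meas
    hd_indep hd_law φ φbar hφ θ₀ P₀ hP₀
  have hD := BinaryFIR.tendsto_gram_of_excitation hN hδ hφ_exc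
  refine ⟨fun k => R.integrable (R.dep_T_pow k 2), fun k hk => ?_, ?_⟩
  · rw [BinaryFIR.information_eq_sum_range]
    refine lt_of_lt_of_le (mul_pos R.c_pos (sub_pos.2 ?_)) (R.fisher_mem k).1
    -- The first excitation window alone lifts `gram` strictly above its initial value 1, hence
    -- positivity from `N` on.
    have h1 := BinaryFIR.le_gram_add hN hφ_exc 0
    have h2 := BinaryFIR.gram_mono (fun k => φ (k + 1)) hk
    have h3 := BinaryFIR.one_le_gram (fun k => φ (k + 1)) 0
    have h4 : (0 : ℝ) < N * δ ^ 2 := mul_pos (by exact_mod_cast hN) (pow_pos hδ 2)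
    rw [zero_add] at h1
    linarith
  · have key := R.tendsto_efficiency hD
    simpa only [BinaryFIR.crBound, inv_inv, BinaryFIR.information_eq_sum_range] using key
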